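/- Conventions. A standard Lebesgue space is a non-atomic probability space isomorphic modulo null sets to $[0,1]$ with Lebesgue measure; a transformation $T$ of it is a measure-preserving map with a measure-preserving almost everywhere inverse; relations between sets are understood modulo null sets. An isomorphism of two systems is a measure-preserving map that intertwines them almost everywhere and has a measure-preserving almost everywhere inverse. $T$ is rank-one if there are integers $r_n>1$ ($n\in\mathbb N=\{0,1,\dots\}$) and $s_{n,i}\ge 0$ ($0<i\le r_n$) such that, with $h_0=1$ and $h_{n+1}=r_nh_n+\sum_{0<i\le r_n}s_{n,i}$, one has $\sum_n (h_{n+1}-r_nh_n)/h_{n+1}<\infty$, and there are measurable sets $B_n$, $B_{n,i}$ ($0<i\le r_n$), $C_{n,i,j}$ ($0<i\le r_n$, $0<j\le s_{n,i}$) such that for all $n$: $\{B_{n,i}\}_{0<i\le r_n}$ is a partition of $B_n$; the levels $T^i(B_n)$, $0\le i<h_n$, are disjoint; $T^{h_n}(B_{n,i})=C_{n,i,1}$ if $s_{n,i}\ne0$; $T^{h_n}(B_{n,i})=B_{n,i+1}$ if $s_{n,i}=0$ and $i<r_n$; $T(C_{n,i,j})=C_{n,i,j+1}$ if $j<s_{n,i}$;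 $T(C_{n,i,s_{n,i}})=B_{n,i+1}$ if $s_{n,i}\neq 0$ and $i<r_n$; $B_{n+1}=B_{n,1}$; and every measurable set is approximated arbitrarily well in measure by unions of levels of some stage-$n$ tower $\{T^i(B_n):0\le i<h_n\}$. Put $I_{m,n}=\{i: 0\le i<h_n,\ T^i(B_n)\subseteq B_m\}$, and let $[i]_k\in\{0,\dots,k-1\}$ denote the residue of $i$ modulo $k$. For integers $k_n>1$ with $k_n\mid k_{n+1}$ for all $n\in\mathbb N$, the odometer of $(k_n)$ is the space of sequences $(\alpha_n)$ with $\alpha_n\in\{0,\dots,k_n-1\}$ and $[\alpha_n]_{k_m}=\alpha_m$ for $m\le n$, with the probability measure giving $\{\alpha_n=i\}$ measure $1/k_n$ for $0\le i<k_n$, and the map $(\alpha_n)\mapsto([\alpha_n+1]_{k_n})$. Its set of divisors is $\bigcup_n\{d: d\mid k_n\}$. Theorem. Let $(X,\mu)$ be a standard Lebesgue space and $T$ a rank-one transformation of it, with a construction as above. The following are equivalent. (I) $T$ is isomorphic to an odometer. (II) For all $l\in\mathbb N$ and $\epsilon>0$ there is an integer $k>1$ such that for all $\eta>0$ there is $N\in\mathbb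 N$ such that for all $n>m\ge N$: (IIa) there is $j\in\{0,\dots,k-1\}$ with $\dfrac{|\{i\in I_{m,n}:[i]_k\ne j\}|}{|I_{m,n}|}<\eta$, and (IIb) there is $D\subseteq\{0,\dots,k-1\}$ with $\dfrac{|\{0\le i\le h_m:[i]_k\in D\}\,\Delta\, I_{l,m}|}{|I_{l,m}|}<\epsilon$. Moreover, if for every $l\in\mathbb N$ and $\epsilon>0$ an integer $k_{l,\epsilon}>1$ as in (II) is chosen, then the set $K$ of all divisors of the numbers $k_{l,\epsilon}$ is infinite, it is the set of divisors of some odometer, and $T$ is isomorphic to every odometer whose set of divisors is $K$. -/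

import Mathlib

open MeasureTheory Set

/-! ### Measure-preserving maps and isomorphisms modulo null sets -/

/-- `φ` is measure-preserving: preimages of measurable sets are measurable (for the completed
measure, so that only the values of `φ` on a set of full measure matter) and have the same
measure. -/
def IsMeasurePreservingMod0 {X Y : Type*} [MeasurableSpace X] [MeasurableSpace Y]
    (μ : Measure X) (ν : Measure Y) (φ : X → Y) : Prop :=
  ∀ A : Set Y, MeasurableSet A → NullMeasurableSet (φ ⁻¹' A) μ ∧ μ (φ ⁻¹' A) = ν A

/-- `φ` and `ψ` are measure-preserving maps that are inverse to each other almost everywhere. -/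
structure IsInvertibleMod0 {X Y : Type*} [MeasurableSpace X] [MeasurableSpace Y]
    (μ : Measure X) (ν : Measure Y) (φ : X → Y) (ψ : Y → X) : Prop where
  map_preserving : IsMeasurePreservingMod0 μ ν φ
  inv_preserving : IsMeasurePreservingMod0 ν μ ψ
  left_inv : ∀ᵐ x ∂μ, ψ (φ x) = x
  right_inv : ∀ᵐ y ∂ν, φ (ψ y) = y

/-- A standard Lebesgue space (non-atomic, of total measure one): a measure space that is
isomorphic modulo null sets to the unit interval with Lebesgue measure. -/
def IsStandardLebesgue {X : Type*} [MeasurableSpace X] (μ : Measure X) : Prop :=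
  ∃ (φ : X → ℝ) (ψ : ℝ → X), IsInvertibleMod0 μ (volume.restrict (Icc (0 : ℝ) 1)) φ ψ

/-- An invertible measure-preserving transformation of `(X, μ)`, with a choice `invFun` of its
almost everywhere defined inverse. -/
structure Transformation {X : Type*} [MeasurableSpace X] (μ : Measure X) where
  toFun : X → X
  invFun : X → X
  invertible : IsInvertibleMod0 μ μ toFun invFun

/-- The image `T ^ k (A)`, written as the preimage of `A` under the `k`-th iterate of the inverse.
(For maps that are invertible only almost everywhere this is the image modulo null sets, while the
literal image could be enlarged by the values of `T` on a null set.) -/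
def Transformation.image {X : Type*} [MeasurableSpace X] {μ : Measure X} (T : Transformation μ)
    (k : ℕ) (A : Set X) : Set X :=
  (T.invFun^[k]) ⁻¹' A

/-- The systems `(X, μ, T)` and `(Y, ν, S)` are isomorphic. -/
def AreIsomorphic {X Y : Type*} [MeasurableSpace X] [MeasurableSpace Y]
    (μ : Measure X) (T : X → X) (ν : Measure Y) (S : Y → Y) : Prop :=
  ∃ (φ : X → Y) (ψ : Y → X), IsInvertibleMod0 μ ν φ ψ ∧ ∀ᵐ x ∂μ, φ (T x) = S (φ x)

/-! ### Rank-one transformations -/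

/-- The heights `h 0 = 1`, `h (n + 1) = r n * h n + ∑_{0 < i ≤ r n} s n i`. -/
def towerHeight (r : ℕ → ℕ) (s : ℕ → ℕ → ℕ) : ℕ → ℕ
  | 0 => 1
  | n + 1 => r n * towerHeight r s n + ∑ i ∈ Finset.Icc 1 (r n), s n i

/-- A cutting and stacking construction of `T`, with cutting parameter `r` and spacer parameter
`s`; `T` is rank-one if it has one. The sets `B' n i` (the `i`-th piece of the base `B n`) are
relevant for `0 < i ≤ r n`, the spacers `C n i j` for `0 < i ≤ r n`, `0 < j ≤ s n i`.
Relations between sets are understood modulo null sets. -/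
structure RankOneConstruction {X : Type*} [MeasurableSpace X] {μ : Measure X}
    (T : Transformation μ) where
  r : ℕ → ℕ
  s : ℕ → ℕ → ℕ
  one_lt_r : ∀ n, 1 < r n
  summable_spacers : Summable fun n : ℕ =>
    ((towerHeight r s (n + 1) : ℝ) - r n * towerHeight r s n) / towerHeight r s (n + 1)
  B : ℕ → Set X
  B' : ℕ → ℕ → Set X
  C : ℕ → ℕ → ℕ → Set X
  measurable_B : ∀ n, NullMeasurableSet (B n) μ
  measurable_B' : ∀ n i, 0 < i → i ≤ r n → NullMeasurableSet (B' n i) μ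
  measurable_C : ∀ n i j, 0 < i → i ≤ r n → 0 < j → j ≤ s n i → NullMeasurableSet (C n i j) μ
  pieces_disjoint : ∀ n i j, 0 < i → i ≤ r n → 0 < j → j ≤ r n → i ≠ j →
    AEDisjoint μ (B' n i) (B' n j)
  pieces_union : ∀ n, (⋃ i ∈ Finset.Icc 1 (r n), B' n i) =ᵐ[μ] B n
  levels_disjoint : ∀ n i j, i < towerHeight r s n → j < towerHeight r s n → i ≠ j →
    AEDisjoint μ (T.image i (B n)) (T.image j (B n))
  top_to_spacer : ∀ n i, 0 < i → i ≤ r n → s n i ≠ 0 →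
    T.image (towerHeight r s n) (B' n i) =ᵐ[μ] C n i 1
  top_to_piece : ∀ n i, 0 < i → i < r n → s n i = 0 →
    T.image (towerHeight r s n) (B' n i) =ᵐ[μ] B' n (i + 1)
  spacer_to_spacer : ∀ n i j, 0 < i → i ≤ r n → 0 < j → j < s n i →
    T.image 1 (C n i j) =ᵐ[μ] C n i (j + 1)
  spacer_to_piece : ∀ n i, 0 < i → i < r n → s n i ≠ 0 →
    T.image 1 (C n i (s n i)) =ᵐ[μ] B' n (i + 1)
  base_succ : ∀ n, B (n + 1) =ᵐ[μ] B' n 1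
  dense : ∀ A : Set X, MeasurableSet A → ∀ ε : ENNReal, 0 < ε →
    ∃ (n : ℕ) (D : Finset ℕ), D ⊆ Finset.range (towerHeight r s n) ∧
      μ (symmDiff A (⋃ i ∈ D, T.image i (B n))) < ε

namespace RankOneConstruction

variable {X : Type*} [MeasurableSpace X] {μ : Measure X} {T : Transformation μ}

/-- The height of the stage-`n` tower. -/
def h (R : RankOneConstruction T) (n : ℕ) : ℕ := towerHeight R.r R.s n

open Classical in
/-- `I_{m,n}`: the indices of the levels of the stage-`n` tower that are contained in the base of
the stage-`m` tower. -/
noncomputable def I (R : RankOneConstruction T) (m n : ℕ) : Finset ℕ :=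
  (Finset.range (R.h n)).filter fun i => T.image i (R.B n) ≤ᵐ[μ] R.B m

/-- The combinatorial condition on `k`, for given `l` and `ε`: for every `η > 0`, for all
sufficiently large `m < n`, all but a proportion `η` of `I_{m,n}` lies in one residue class
modulo `k`, and `I_{l,m}` is `ε`-approximated by a union of residue classes modulo `k`. -/
def ResidueCondition (R : RankOneConstruction T) (l : ℕ) (ε : ℝ) (k : ℕ) : Prop :=
  ∀ η : ℝ, 0 < η → ∃ N : ℕ, ∀ m n : ℕ, N ≤ m → m < n →
    (∃ j < k, (((R.I m n).filter fun i => i % k ≠ j).card : ℝ) / (R.I m n).card < η) ∧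
    (∃ D ⊆ Finset.range k,
      ((symmDiff ((Finset.range (R.h m + 1)).filter fun i => i % k ∈ D) (R.I l m)).card : ℝ)
        / (R.I l m).card < ε)

end RankOneConstruction

/-! ### Odometers -/

/-- A sequence of integers greater than one, each dividing the next. -/
structure OdometerSeq where
  k : ℕ → ℕ
  one_lt : ∀ n, 1 < k n
  dvd_succ : ∀ n, k n ∣ k (n + 1)

namespace OdometerSeq

variable (O : OdometerSeq)

theorem dvd_of_le {m n : ℕ} (h : m ≤ n) : O.k m ∣ O.k n :=
  Nat.le_induction dvd_rfl (fun i _ ih => ih.trans (O.dvd_succ i)) n h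

theorem k_pos (n : ℕ) : 0 < O.k n := lt_trans Nat.zero_lt_one (O.one_lt n)

/-- The set of all divisors of the terms of the sequence. -/
def divisorSet : Set ℕ := {d | ∃ n, d ∣ O.k n}

/-- The underlying space: coherent sequences of residues, `α n ∈ {0, …, k n - 1}`. Its
σ-algebra is the one generated by the coordinates. -/
abbrev Space : Type :=
  {α : ℕ → ℕ // (∀ n, α n < O.k n) ∧ ∀ m n, m ≤ n → α n % O.k m = α m}

/-- The odometer map: add one in each coordinate. -/
def shift (α : O.Space) : O.Space :=
  ⟨fun n => (α.1 n + 1) % O.k n, fun n => Nat.mod_lt _ (O.k_pos n), fun m n hmn => by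
    rw [Nat.mod_mod_of_dvd _ (O.dvd_of_le hmn), Nat.add_mod, α.2.2 m n hmn, ← Nat.add_mod_mod]
    simp⟩

/-- The place values `1, k 0, k 1, …` of the digits. -/
def base : ℕ → ℕ
  | 0 => 1
  | n + 1 => O.k n

/-- The number of values of the `n`-th digit. -/
def radix (n : ℕ) : ℕ := O.k n / O.base n

theorem base_dvd (n : ℕ) : O.base n ∣ O.k n := by
  cases n with
  | zero => exact one_dvd _
  | succ n => exact O.dvd_succ n

theorem base_pos (n : ℕ) : 0 < O.base n := Nat.pos_of_dvd_of_pos (O.base_dvd n) (O.k_pos n)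

theorem base_mul_radix (n : ℕ) : O.base n * O.radix n = O.k n :=
  Nat.mul_div_cancel' (O.base_dvd n)

theorem radix_pos (n : ℕ) : 0 < O.radix n :=
  Nat.div_pos (Nat.le_of_dvd (O.k_pos n) (O.base_dvd n)) (O.base_pos n)

/-- The law of the `n`-th digit: uniform on `{0, …, radix n - 1}`. -/
noncomputable def digitLaw (n : ℕ) : Measure ℕ :=
  (PMF.uniformOfFinset (Finset.range (O.radix n))
    (Finset.nonempty_range_iff.2 (O.radix_pos n).ne')).toMeasure

instance (n : ℕ) : IsProbabilityMeasure (O.digitLaw n) := by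
  unfold digitLaw; infer_instance

/-- The number with digits `ω 0, …, ω n`. -/
def value (ω : ℕ → ℕ) (n : ℕ) : ℕ := ∑ j ∈ Finset.range (n + 1), ω j * O.base j

/-- The point of the odometer with the digits `ω`. -/
def ofDigits (ω : ℕ → ℕ) : O.Space :=
  ⟨fun n => O.value ω n % O.k n, fun n => Nat.mod_lt _ (O.k_pos n), fun m n hmn => by
    rw [Nat.mod_mod_of_dvd _ (O.dvd_of_le hmn)]
    induction n, hmn using Nat.le_induction with
    | base => rfl
    | succ n hmn ih =>
      have hd : ω (n + 1) * O.base (n + 1) % O.k m = 0 :=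
        Nat.mod_eq_zero_of_dvd ((O.dvd_of_le hmn).mul_left _)
      rw [← ih, value, Finset.sum_range_succ, ← value, Nat.add_mod, hd]
      simp⟩

/-- The natural measure of the odometer: the distribution of a point with independent, uniformly
distributed digits. It is the one with `{α | α n = i}` of measure `1 / k n`, see
`measure_cylinder`. -/
noncomputable def measure : Measure O.Space :=
  (Measure.infinitePi O.digitLaw).map O.ofDigits

theorem measurable_ofDigits : Measurable O.ofDigits := by
  refine Measurable.subtype_mk (measurable_pi_lambda _ fun n => ?_)
  have h : Measurable fun ω : ℕ → ℕ => O.value ω n :=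
    Finset.measurable_sum _ fun j _ => (measurable_pi_apply j).mul_const _
  exact (measurable_of_countable fun x : ℕ => x % O.k n).comp h

/-- The `j`-th digit of `x`. -/
def digit (x j : ℕ) : ℕ := x / O.base j % O.radix j

theorem value_digit (x n : ℕ) : O.value (O.digit x) n = x % O.k n := by
  induction n with
  | zero => simp [value, digit, base, radix]
  | succ n ih =>
    rw [value, Finset.sum_range_succ, ← value, ih, ← O.base_mul_radix (n + 1)]
    simp only [digit, base]
    rw [Nat.mod_mul, mul_comm]

theorem value_lt {ω : ℕ → ℕ} {n : ℕ} (h : ∀ j ≤ n, ω j < O.radix j) : O.value ω n < O.k n := by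
  induction n with
  | zero => simpa [value, base, radix] using h 0 le_rfl
  | succ n ih =>
    have h1 := ih fun j hj => h j (hj.trans n.le_succ)
    have h2 := h (n + 1) le_rfl
    rw [value, Finset.sum_range_succ, ← value, ← O.base_mul_radix (n + 1)]
    simp only [base]
    nlinarith

theorem digit_value {ω : ℕ → ℕ} {n : ℕ} (h : ∀ j ≤ n, ω j < O.radix j) :
    ∀ j ≤ n, O.digit (O.value ω n) j = ω j := by
  induction n with
  | zero =>
    intro j hj
    obtain rfl : j = 0 := by omega
    simpa [value, base, digit] using Nat.mod_eq_of_lt (h 0 le_rfl)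
  | succ n ih =>
    intro j hj
    have h1 := O.value_lt fun j hj => h j (hj.trans n.le_succ)
    rw [value, Finset.sum_range_succ, ← value]
    rcases Nat.lt_or_ge n j with hj' | hj'
    · obtain rfl : j = n + 1 := by omega
      simp only [digit, base]
      rw [Nat.add_mul_div_right _ _ (O.k_pos n), Nat.div_eq_of_lt h1, zero_add]
      exact Nat.mod_eq_of_lt (h (n + 1) le_rfl)
    · rw [← ih (fun j hj => h j (hj.trans n.le_succ)) j hj']
      have hd : ω (n + 1) * O.base (n + 1) % O.k j = 0 :=
        Nat.mod_eq_zero_of_dvd ((O.dvd_of_le hj').mul_left _)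
      simp only [digit]
      rw [← Nat.mod_mul_right_div_self, ← Nat.mod_mul_right_div_self, O.base_mul_radix,
        Nat.add_mod, hd]
      simp

theorem digitLaw_singleton {n i : ℕ} (hi : i < O.radix n) :
    O.digitLaw n {i} = (O.radix n : ENNReal)⁻¹ := by
  rw [digitLaw, PMF.toMeasure_apply_singleton _ _ (measurableSet_singleton i)]
  simp [PMF.uniformOfFinset_apply, hi]

theorem ae_digit_lt (n : ℕ) : ∀ᵐ ω ∂(Measure.infinitePi O.digitLaw), ω n < O.radix n := by
  have h := (measurePreserving_eval_infinitePi O.digitLaw n).quasiMeasurePreserving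
  refine h.ae (p := fun x => x < O.radix n) ?_
  rw [digitLaw, ae_iff, PMF.toMeasure_apply_eq_zero_iff _ (MeasurableSet.of_discrete)]
  rw [PMF.support_uniformOfFinset, Set.disjoint_left]
  intro a ha ha'
  exact ha' (by simpa using ha)

theorem prod_radix (n : ℕ) : ∏ j ∈ Finset.range (n + 1), O.radix j = O.k n := by
  induction n with
  | zero => simp [radix, base]
  | succ n ih => rw [Finset.prod_range_succ, ih]; exact O.base_mul_radix (n + 1)

theorem measure_cylinder (n i : ℕ) (hi : i < O.k n) :
    O.measure {α : O.Space | α.1 n = i} = (O.k n : ENNReal)⁻¹ := by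
  have hm : MeasurableSet {α : O.Space | α.1 n = i} :=
    measurableSet_eq_fun ((measurable_pi_apply n).comp measurable_subtype_coe) measurable_const
  rw [measure, Measure.map_apply O.measurable_ofDigits hm]
  have hae : O.ofDigits ⁻¹' {α : O.Space | α.1 n = i} =ᵐ[Measure.infinitePi O.digitLaw]
      Set.pi (Finset.range (n + 1)) fun j => {O.digit i j} := by
    have hall := ae_all_iff.2 O.ae_digit_lt
    filter_upwards [hall] with ω hω
    refine propext ?_
    change O.value ω n % O.k n = i ↔ ω ∈ Set.pi (Finset.range (n + 1)) fun j => {O.digit i j}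
    rw [Nat.mod_eq_of_lt (O.value_lt fun j _ => hω j)]
    constructor
    · rintro rfl j hj
      have hj' : j ≤ n := by simpa [Nat.lt_succ_iff] using hj
      exact (O.digit_value (fun j _ => hω j) j hj').symm
    · intro h
      rw [← Nat.mod_eq_of_lt hi, ← O.value_digit]
      exact Finset.sum_congr rfl fun j hj => by rw [h j hj]
  rw [measure_congr hae, Measure.infinitePi_pi _ fun j _ => measurableSet_singleton _]
  have hlaw : ∀ j ∈ Finset.range (n + 1),
      O.digitLaw j {O.digit i j} = (O.radix j : ENNReal)⁻¹ :=
    fun j _ => O.digitLaw_singleton (Nat.mod_lt _ (O.radix_pos j))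
  rw [Finset.prod_congr rfl hlaw]
  rw [← ENNReal.prod_inv_distrib, ← O.prod_radix n, Nat.cast_prod]
  intro a _ b _ _
  exact Or.inr (ENNReal.natCast_ne_top _)

end OdometerSeq

/-!
For a fixed modulus `k`, condition (IIa) says that the return times to the late bases concentrate
in one residue class. This is equivalent to the existence of an eigenfunction of `T` with values
in `ℤ/k`, that is a function `f` with `f ∘ T = f + 1` almost everywhere. Given (IIa), the index of
the level containing a point, taken modulo `k` and corrected by the accumulated residues of the
return times, converges almost everywhere to such an `f`. Conversely, the levels generate the
σ-algebra, so an eigenfunction is nearly constant on late bases, whose return times then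
concentrate. In the presence of `f`, condition (IIb) says that `B l` is approximated by a union of
fibres of `f`.

If late bases are well approximated by fibres of `f`, the order of any other eigenfunction divides
`k`; hence the orders in (II) are directed under divisibility, and their divisors are those of an
odometer. By ergodicity eigenfunctions of the same order differ by a constant, so eigenfunctions
of orders `O.k n` can be adjusted to form a coherent sequence, which is a factor map onto the
odometer. By (IIb) the bases, and therefore all measurable sets, are measurable modulo null sets
with respect to this factor, so the factor map is invertible almost everywhere.
-/

open Filter

section Measure

variable {X : Type*} [MeasurableSpace X] {μ : Measure X}

instance isProbabilityMeasure_completion [IsProbabilityMeasure μ] :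
    IsProbabilityMeasure μ.completion :=
  ⟨measure_univ (μ := μ)⟩

theorem measureReal_mono_ae [IsFiniteMeasure μ] {A A' : Set X} (h : A ≤ᵐ[μ] A') :
    μ.real A ≤ μ.real A' :=
  ENNReal.toReal_mono (measure_ne_top _ _) (measure_mono_ae h)

theorem ae_eventually_notMem_of_summable [IsFiniteMeasure μ] {s : ℕ → Set X} {u : ℕ → ℝ}
    (hu : Summable u) (hs : ∀ p, μ.real (s p) ≤ u p) : ∀ᵐ x ∂μ, ∀ᶠ p in atTop, x ∉ s p := by
  refine ae_eventually_notMem (ne_top_of_le_ne_top hu.tsum_ofReal_ne_top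
    (ENNReal.tsum_le_tsum fun p => ?_))
  rw [← ofReal_measureReal]
  exact ENNReal.ofReal_le_ofReal (hs p)

theorem exists_measurable_eventually_eq {β : Type*} [MeasurableSpace β]
    [DiscreteMeasurableSpace β] {g : ℕ → X → β} (hg : ∀ p, Measurable (g p))
    (h : ∀ᵐ x ∂μ, ∀ᶠ p in atTop, g (p + 1) x = g p x) :
    ∃ f : X → β, Measurable f ∧ ∀ᵐ x ∂μ, ∀ᶠ p in atTop, g p x = f x := by
  let _ : TopologicalSpace β := ⊥
  have : DiscreteTopology β := ⟨rfl⟩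
  obtain ⟨f, hfm, hf⟩ := measurable_limit_of_tendsto_metrizable_ae (L := atTop)
    (fun p => (hg p).aemeasurable) <| by
      filter_upwards [h] with x hx
      obtain ⟨N, hN⟩ := eventually_atTop.1 hx
      refine ⟨g N x, tendsto_const_nhds.congr' ?_⟩
      filter_upwards [eventually_ge_atTop N] with p hp
      induction p, hp using Nat.le_induction with
      | base => rfl
      | succ p hp ih => rw [hN p hp, ← ih]
  refine ⟨f, hfm, ?_⟩
  filter_upwards [hf] with x hx
  rwa [nhds_discrete, tendsto_pure] at hx

theorem eventuallyMeasurableSet_of_forall_approx {X : Type*} {m : MeasurableSpace X}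
    [MeasurableSpace X] {μ : Measure X} [IsFiniteMeasure μ] {A : Set X} (h : ∀ ε : ℝ, 0 < ε →
      ∃ A', EventuallyMeasurableSet m (ae μ) A' ∧ μ.real (symmDiff A A') < ε) :
    EventuallyMeasurableSet m (ae μ) A := by
  choose G hGm hG using fun p : ℕ => h ((1 / 2 : ℝ) ^ p) (by positivity)
  have hlim : EventuallyMeasurableSet m (ae μ) (liminf G atTop) :=
    @MeasurableSet.measurableSet_liminf X (eventuallyMeasurableSpace m (ae μ)) G hGm
  refine hlim.congr ?_
  filter_upwards [ae_eventually_notMem_of_summable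
    (summable_geometric_of_lt_one (by norm_num) (by norm_num)) fun p => (hG p).le] with x hx
  have hiff : ∀ᶠ p in atTop, (x ∈ A ↔ x ∈ G p) := by
    filter_upwards [hx] with p hp
    rw [mem_symmDiff] at hp
    tauto
  apply propext
  change x ∈ A ↔ x ∈ liminf G atTop
  rw [mem_liminf_iff_eventually_mem, ← eventually_const (f := atTop (α := ℕ)) (p := x ∈ A)]
  exact eventually_congr hiff

/- Off the countably many exceptional null sets attached to a countable generating family, `u` is
measurable for the pulled back σ-algebra on the nose. -/
theorem exists_measurable_comp_ae_eq {Y Z : Type*} [mY : MeasurableSpace Y] [MeasurableSpace Z]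
    [StandardBorelSpace Z] [Nonempty Z] {Φ : X → Y} {u : X → Z}
    (hu : EventuallyMeasurable (mY.comap Φ) (ae μ) u) :
    ∃ g : Y → Z, Measurable g ∧ g ∘ Φ =ᵐ[μ] u := by
  have hgen : ∀ C ∈ MeasurableSpace.countableGeneratingSet Z,
      ∃ A, MeasurableSet A ∧ u ⁻¹' C =ᵐ[μ] Φ ⁻¹' A := fun C hC => by
    obtain ⟨_, ⟨A, hA, rfl⟩, h⟩ := hu (MeasurableSpace.measurableSet_countableGeneratingSet hC)
    exact ⟨A, hA, h⟩
  choose! A hA hAu using hgen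
  have hgood : ∀ᵐ x ∂μ, ∀ C ∈ MeasurableSpace.countableGeneratingSet Z, u x ∈ C ↔ Φ x ∈ A C :=
    (ae_ball_iff (MeasurableSpace.countable_countableGeneratingSet)).2
      fun C hC => (hAu C hC).mem_iff
  let N : Set X := {x | ∀ C ∈ MeasurableSpace.countableGeneratingSet Z, u x ∈ C ↔ Φ x ∈ A C}
  have hrestr : Measurable[mY.comap fun x : N => Φ x] fun x : N => u x := by
    rw [← MeasurableSpace.generateFrom_countableGeneratingSet (α := Z)]
    refine @measurable_generateFrom _ _ (_) _ _ fun C hC => ⟨A C, hA C hC, ?_⟩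
    ext x
    exact (x.2 C hC).symm
  obtain ⟨g, hg, hgu⟩ := hrestr.exists_eq_measurable_comp
  refine ⟨g, hg, ?_⟩
  filter_upwards [hgood] with x hx
  exact (congrFun hgu ⟨x, hx⟩).symm

end Measure

namespace IsMeasurePreservingMod0

variable {X Y : Type*} [MeasurableSpace X] [MeasurableSpace Y] {μ : Measure X} {ν : Measure Y}
  {φ : X → Y}

theorem ae (hφ : IsMeasurePreservingMod0 μ ν φ) {p : Y → Prop} (hp : ∀ᵐ y ∂ν, p y) :
    ∀ᵐ x ∂μ, p (φ x) := by
  refine measure_mono_null (preimage_mono (subset_toMeasurable ν {y | p y}ᶜ)) ?_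
  rw [(hφ _ (measurableSet_toMeasurable ν _)).2, measure_toMeasurable]
  exact hp

theorem nullMeasurableSet_preimage (hφ : IsMeasurePreservingMod0 μ ν φ) {A : Set Y}
    (hA : NullMeasurableSet A ν) : NullMeasurableSet (φ ⁻¹' A) μ := by
  obtain ⟨A', -, hA', hAA'⟩ := hA.exists_measurable_superset_ae_eq
  exact (hφ A' hA').1.congr (hφ.ae hAA')

theorem measure_preimage (hφ : IsMeasurePreservingMod0 μ ν φ) {A : Set Y}
    (hA : NullMeasurableSet A ν) : μ (φ ⁻¹' A) = ν A := by
  obtain ⟨A', -, hA', hAA'⟩ := hA.exists_measurable_superset_ae_eq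
  rw [← measure_congr hAA', ← (hφ A' hA').2]
  exact measure_congr (hφ.ae hAA'.symm)

theorem measurePreserving_completion (hφ : IsMeasurePreservingMod0 μ ν φ) :
    @MeasurePreserving (NullMeasurableSpace X μ) (NullMeasurableSpace Y ν) _ _ φ
      μ.completion ν.completion := by
  have hm : @Measurable (NullMeasurableSpace X μ) (NullMeasurableSpace Y ν) _ _ φ :=
    fun A hA => hφ.nullMeasurableSet_preimage hA
  refine ⟨hm, Measure.ext fun A hA => ?_⟩
  rw [Measure.map_apply hm hA]
  exact hφ.measure_preimage hA

end IsMeasurePreservingMod0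

theorem IsStandardLebesgue.isProbabilityMeasure {X : Type*} [MeasurableSpace X] {μ : Measure X}
    (hμ : IsStandardLebesgue μ) : IsProbabilityMeasure μ := by
  obtain ⟨φ, ψ, h⟩ := hμ
  have huniv := (h.map_preserving univ MeasurableSet.univ).2
  exact ⟨by rw [← preimage_univ (f := φ), huniv]; simp⟩

section Inverse

variable {X Y Z : Type*} [MeasurableSpace X] [mY : MeasurableSpace Y] [MeasurableSpace Z]
  {μ : Measure X} {ν : Measure Y} {ρ : Measure Z} {Φ : X → Y} {φ : X → Z} {ψ : Z → X}

theorem IsMeasurePreservingMod0.ae_rightInverse_of_ae_leftInverse [MeasurableEq Y]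
    (hΦ : IsMeasurePreservingMod0 μ ν Φ) {Ψ : Y → X} (hΨ : IsMeasurePreservingMod0 ν μ Ψ)
    (hleft : ∀ᵐ x ∂μ, Ψ (Φ x) = x) : ∀ᵐ y ∂ν, Φ (Ψ y) = y := by
  have hcomp : @Measurable (NullMeasurableSpace Y ν) Y _ _ fun y => Φ (Ψ y) :=
    fun A hA => hΨ.nullMeasurableSet_preimage (hΦ A hA).1
  have hid : @Measurable (NullMeasurableSpace Y ν) Y _ _ fun y => y :=
    fun A hA => MeasurableSet.nullMeasurableSet hA
  have hbad : NullMeasurableSet {y | Φ (Ψ y) = y}ᶜ ν := (measurableSet_eq_fun hcomp hid).compl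
  change ν {y | Φ (Ψ y) = y}ᶜ = 0
  rw [← hΦ.measure_preimage hbad, measure_eq_zero_iff_ae_notMem]
  filter_upwards [hleft] with x hx h
  exact h (congrArg Φ hx)

/- The inverse is `ψ ∘ g`, where `φ = g ∘ Φ` almost everywhere. -/
theorem IsInvertibleMod0.exists_of_le_eventuallyMeasurableSpace [StandardBorelSpace Z]
    [Nonempty Z] [MeasurableEq Y] (h : IsInvertibleMod0 μ ρ φ ψ)
    (hΦ : IsMeasurePreservingMod0 μ ν Φ)
    (hgen : ∀ A, MeasurableSet A → EventuallyMeasurableSet (mY.comap Φ) (MeasureTheory.ae μ) A) :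
    ∃ Ψ : Y → X, IsInvertibleMod0 μ ν Φ Ψ := by
  obtain ⟨g, hg, hgφ⟩ : ∃ g : Y → Z, Measurable g ∧ g ∘ Φ =ᵐ[μ] φ := by
    refine exists_measurable_comp_ae_eq fun C hC => ?_
    obtain ⟨A, -, hA, hAC⟩ := (h.map_preserving C hC).1.exists_measurable_superset_ae_eq
    exact (hgen A hA).congr hAC.symm
  have hgρ : MeasurePreserving g ν ρ := by
    refine ⟨hg, Measure.ext fun C hC => ?_⟩
    rw [Measure.map_apply hg hC, ← (hΦ _ (hg hC)).2, ← (h.map_preserving C hC).2]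
    exact measure_congr (hgφ.preimage C)
  have hΨ : IsMeasurePreservingMod0 ν μ (ψ ∘ g) := fun A hA => by
    obtain ⟨hmeas, hmeasure⟩ := h.inv_preserving A hA
    rw [preimage_comp]
    exact ⟨hmeas.preimage hgρ.quasiMeasurePreserving, by rw [hgρ.measure_preimage hmeas, hmeasure]⟩
  have hleft : ∀ᵐ x ∂μ, (ψ ∘ g) (Φ x) = x := by
    filter_upwards [hgφ, h.left_inv] with x hgx hψx
    rw [Function.comp_apply, ← Function.comp_apply (f := g), hgx, hψx]
  exact ⟨ψ ∘ g, hΦ, hΨ, hleft, hΦ.ae_rightInverse_of_ae_leftInverse hΨ hleft⟩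

end Inverse

namespace Transformation

variable {X : Type*} [MeasurableSpace X] {μ : Measure X} (T : Transformation μ)

theorem ae_iterate_invFun (i : ℕ) {p : X → Prop} (hp : ∀ᵐ x ∂μ, p x) :
    ∀ᵐ x ∂μ, p (T.invFun^[i] x) := by
  have h := T.invertible.inv_preserving.measurePreserving_completion.iterate i
  rw [← Measure.ae_completion] at hp ⊢
  exact h.quasiMeasurePreserving.ae hp

theorem image_congr (i : ℕ) {A A' : Set X} (h : A =ᵐ[μ] A') : T.image i A =ᵐ[μ] T.image i A' :=
  T.ae_iterate_invFun i h

theorem image_image (i j : ℕ) (A : Set X) : T.image i (T.image j A) = T.image (j + i) A := by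
  rw [image, image, image, ← preimage_comp, ← Function.iterate_add]

theorem image_biUnion (i : ℕ) {ι : Type*} (D : Finset ι) (A : ι → Set X) :
    T.image i (⋃ j ∈ D, A j) = ⋃ j ∈ D, T.image i (A j) := by
  simp only [image, preimage_iUnion]

end Transformation

section Eigenfunction

variable {X : Type*} [MeasurableSpace X] {μ : Measure X} {S : X → X}

/-- `f` is an eigenfunction of order `k`, written additively: composing `f` with a character of
order `k` of `ZMod k` gives an eigenfunction in the usual sense. As `S` plays the role of the
inverse of the transformation, `f` decreases by one along `S`. -/
structure IsEigenfunction (μ : Measure X) (S : X → X) {k : ℕ} (f : X → ZMod k) : Prop where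
  measurable : Measurable f
  map_add_one : ∀ᵐ x ∂μ, f (S x) + 1 = f x

theorem exists_isEigenfunction_of_summable [IsFiniteMeasure μ] (hS : MeasurePreserving S μ μ)
    {k : ℕ} {g : ℕ → X → ZMod k} {u : ℕ → ℝ} (hu : Summable u)
    (hg : ∀ p, Measurable (g p)) (hstep : ∀ p, μ.real {x | g (p + 1) x ≠ g p x} ≤ u p)
    (hmap : ∀ p, μ.real {x | g p (S x) + 1 ≠ g p x} ≤ u p) :
    ∃ f : X → ZMod k, IsEigenfunction μ S f := by
  obtain ⟨f, hf, hlim⟩ := exists_measurable_eventually_eq hg <|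
    (ae_eventually_notMem_of_summable hu hstep).mono fun x hx => hx.mono fun p => not_not.1
  refine ⟨f, hf, ?_⟩
  filter_upwards [hlim, hS.quasiMeasurePreserving.ae hlim,
    ae_eventually_notMem_of_summable hu hmap] with x hx hSx hmapx
  obtain ⟨p, ⟨hpx, hpSx⟩, hp⟩ := ((hx.and hSx).and hmapx).exists
  rw [← hpx, ← hpSx]
  exact not_not.1 hp

namespace IsEigenfunction

variable {k : ℕ} {f : X → ZMod k}

theorem measurableSet_preimage (hf : IsEigenfunction μ S f) (E : Set (ZMod k)) :
    MeasurableSet (f ⁻¹' E) :=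
  hf.measurable .of_discrete

theorem congr (hS : MeasurePreserving S μ μ) (hf : IsEigenfunction μ S f) {g : X → ZMod k}
    (hg : Measurable g) (hfg : f =ᵐ[μ] g) : IsEigenfunction μ S g where
  measurable := hg
  map_add_one := by
    filter_upwards [hf.map_add_one, hfg, hS.quasiMeasurePreserving.ae hfg] with x hx hgx hgSx
    rw [← hgx, ← hgSx, hx]

theorem cast (hf : IsEigenfunction μ S f) {d : ℕ} (hd : d ∣ k) :
    IsEigenfunction μ S fun x => ZMod.castHom hd (ZMod d) (f x) where
  measurable := Measurable.of_discrete.comp hf.measurable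
  map_add_one := by
    filter_upwards [hf.map_add_one] with x hx
    rw [← hx, map_add, map_one]

theorem add_const (hf : IsEigenfunction μ S f) (c : ZMod k) :
    IsEigenfunction μ S fun x => f x + c where
  measurable := (Measurable.of_discrete (f := (· + c))).comp hf.measurable
  map_add_one := by
    filter_upwards [hf.map_add_one] with x hx
    rw [← hx]
    ring

theorem iterate (hf : IsEigenfunction μ S f) (hS : MeasurePreserving S μ μ) (i : ℕ) :
    ∀ᵐ x ∂μ, f (S^[i] x) + i = f x := by
  induction i with
  | zero => simp
  | succ i ih =>
    filter_upwards [ih, (hS.iterate i).quasiMeasurePreserving.ae hf.map_add_one] with x hx hSx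
    rw [Function.iterate_succ_apply', ← hx, ← hSx]
    push_cast
    ring

theorem preimage_iterate (hf : IsEigenfunction μ S f) (hS : MeasurePreserving S μ μ) (i : ℕ)
    (E : Set (ZMod k)) : S^[i] ⁻¹' (f ⁻¹' E) =ᵐ[μ] {x | f x - i ∈ E} := by
  filter_upwards [hf.iterate hS i] with x hx
  apply propext
  change f (S^[i] x) ∈ E ↔ f x - i ∈ E
  rw [← hx, add_sub_cancel_right]

theorem measureReal_preimage_iterate_inter (hf : IsEigenfunction μ S f)
    (hS : MeasurePreserving S μ μ) (i : ℕ) {A : Set X} (hA : MeasurableSet A)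
    (E : Set (ZMod k)) :
    μ.real (S^[i] ⁻¹' A ∩ {x | f x - i ∈ E}) = μ.real (A ∩ f ⁻¹' E) := by
  rw [← (hS.iterate i).measureReal_preimage
    (hA.inter (hf.measurableSet_preimage E)).nullMeasurableSet, preimage_inter]
  exact measureReal_congr ((ae_eq_refl _).inter (hf.preimage_iterate hS i E).symm)

theorem measureReal_fibre [IsProbabilityMeasure μ] [NeZero k] (hf : IsEigenfunction μ S f)
    (hS : MeasurePreserving S μ μ) (c : ZMod k) : μ.real (f ⁻¹' {c}) = 1 / k := by
  have hfibre (c : ZMod k) : μ.real (f ⁻¹' {c}) = μ.real (f ⁻¹' {0}) := by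
    have h := hf.measureReal_preimage_iterate_inter hS c.val .univ {0}
    simp only [preimage_univ, univ_inter, ZMod.natCast_zmod_val] at h
    rw [← h]
    congr 1
    ext x
    simp [sub_eq_zero]
  have hsum : ∑ c : ZMod k, μ.real (f ⁻¹' {c}) = 1 := by
    rw [sum_measureReal_preimage_singleton _ fun c _ => hf.measurableSet_preimage {c}]
    simp
  rw [Finset.sum_congr rfl fun c _ => hfibre c, Finset.sum_const, nsmul_eq_mul, Finset.card_univ,
    ZMod.card] at hsum
  rw [hfibre c]
  exact eq_one_div_of_mul_eq_one_right hsum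

theorem exists_eq_add_const [NeZero k] (hS : Ergodic S μ) (hf : IsEigenfunction μ S f)
    {g : X → ZMod k} (hg : IsEigenfunction μ S g) : ∃ c, ∀ᵐ x ∂μ, g x = f x + c := by
  have hmeas : Measurable fun x => g x - f x := hg.measurable.sub hf.measurable
  have hinv : (fun x => g x - f x) ∘ S =ᵐ[μ] fun x => g x - f x := by
    filter_upwards [hf.map_add_one, hg.map_add_one] with x hfx hgx
    rw [← hfx, ← hgx]
    simp
  obtain ⟨c, hc⟩ := hS.ae_eq_const_of_ae_eq_comp₀ hmeas.nullMeasurable hinv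
  refine ⟨c, ?_⟩
  filter_upwards [hc] with x hx
  exact eq_add_of_sub_eq' hx

theorem exists_lift {d k : ℕ} [NeZero d] (hS : Ergodic S μ) (hd : d ∣ k) {f : X → ZMod d}
    {g : X → ZMod k} (hf : IsEigenfunction μ S f) (hg : IsEigenfunction μ S g) :
    ∃ g' : X → ZMod k, IsEigenfunction μ S g' ∧
      ∀ᵐ x ∂μ, ZMod.castHom hd (ZMod d) (g' x) = f x := by
  obtain ⟨c, hc⟩ := (hg.cast hd).exists_eq_add_const hS hf
  refine ⟨_, hg.add_const (c.val : ZMod k), ?_⟩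
  filter_upwards [hc] with x hx
  rw [hx, map_add, map_natCast, ZMod.natCast_zmod_val]

/- `S^[k']` preserves `g ⁻¹' E` but, unless `k ∣ k'`, maps the fibre of `f` over `c` off itself. -/
theorem dvd_of_measureReal_lt [IsFiniteMeasure μ] (hS : MeasurePreserving S μ μ)
    (hf : IsEigenfunction μ S f) {k' : ℕ} {g : X → ZMod k'} (hg : IsEigenfunction μ S g)
    {E : Set (ZMod k')} {c : ZMod k}
    (h : μ.real (g ⁻¹' E ∩ f ⁻¹' {c}ᶜ) < μ.real (g ⁻¹' E ∩ f ⁻¹' {c})) : k ∣ k' := by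
  by_contra hdvd
  rw [← ZMod.natCast_eq_zero_iff] at hdvd
  refine h.not_ge ?_
  rw [← hf.measureReal_preimage_iterate_inter hS k' (hg.measurableSet_preimage E)]
  refine measureReal_mono_ae ?_
  filter_upwards [hg.iterate hS k'] with x hgx
  rintro ⟨hxE, hxc⟩
  rw [ZMod.natCast_self, add_zero] at hgx
  refine ⟨(congrArg (· ∈ E) hgx).mp hxE, fun hfx : f x = c => hdvd ?_⟩
  have hfx' : f x - k' = c := hxc
  simpa [hfx] using hfx'

theorem one_div_lt_of_measureReal_symmDiff_lt [IsProbabilityMeasure μ] [NeZero k]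
    (hS : MeasurePreserving S μ μ) (hf : IsEigenfunction μ S f) {A : Set X} {E : Set (ZMod k)}
    (h : μ.real (symmDiff A (f ⁻¹' E)) < μ.real A) : 1 / k < 2 * μ.real A := by
  obtain ⟨e, he⟩ : E.Nonempty := by
    by_contra! hE
    simp [hE, symmDiff_def] at h
  rw [← hf.measureReal_fibre hS e]
  have hsub : f ⁻¹' {e} ⊆ symmDiff A (f ⁻¹' E) ∪ A := fun x (hx : f x = e) => by
    by_cases hxA : x ∈ A
    · exact Or.inr hxA
    · exact Or.inl (Or.inr ⟨show f x ∈ E from hx ▸ he, hxA⟩)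
  linarith [(measureReal_mono hsub).trans (measureReal_union_le (μ := μ) _ _)]

end IsEigenfunction

end Eigenfunction

/-- A nested sequence of Rokhlin towers for a measure-preserving map `S`, which plays the role of
the inverse of the transformation: the levels of the stage-`n` tower are the preimages of `B n`
under the first `h n` iterates of `S`, the base `B m` is the union of the levels of the
stage-`n` tower with indices in `I m n`, and the levels approximate every measurable set. -/
structure TowerSystem {X : Type*} [MeasurableSpace X] (μ : Measure X) where
  S : X → X
  preserving : MeasurePreserving S μ μ
  B : ℕ → Set X
  measurableSet_base : ∀ n, MeasurableSet (B n)
  base_ne_zero : ∀ n, μ (B n) ≠ 0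
  h : ℕ → ℕ
  two_pow_le : ∀ n, 2 ^ n ≤ h n
  I : ℕ → ℕ → Finset ℕ
  I_add_le : ∀ m n, m ≤ n → ∀ i ∈ I m n, i + h m ≤ h n
  refine_base : ∀ m n, m ≤ n → B m =ᵐ[μ] ⋃ i ∈ I m n, S^[i] ⁻¹' B n
  levels_disjoint : ∀ n i j, i < h n → j < h n → i ≠ j →
    AEDisjoint μ (S^[i] ⁻¹' B n) (S^[j] ⁻¹' B n)
  dense : ∀ A, MeasurableSet A → ∀ ε : ℝ, 0 < ε → ∃ (n : ℕ) (D : Finset ℕ),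
    D ⊆ Finset.range (h n) ∧ μ.real (symmDiff A (⋃ i ∈ D, S^[i] ⁻¹' B n)) < ε

namespace TowerSystem

section Towers

variable {X : Type*} [MeasurableSpace X] {μ : Measure X} (W : TowerSystem μ)

/-- The `i`-th level of the stage-`n` tower; it is meaningful for every `i`, but only the levels
with `i < W.h n` belong to the tower. -/
def level (n i : ℕ) : Set X := W.S^[i] ⁻¹' W.B n

/-- The union of the levels of the stage-`n` tower. -/
def tower (n : ℕ) : Set X := ⋃ i ∈ Finset.range (W.h n), W.level n i

/-- The measure of the base of the stage-`n` tower, hence of each of its levels. -/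
noncomputable def width (n : ℕ) : ℝ := μ.real (W.B n)

theorem h_pos (n : ℕ) : 0 < W.h n := (pow_pos two_pos n).trans_le (W.two_pow_le n)

theorem measurableSet_level (n i : ℕ) : MeasurableSet (W.level n i) :=
  (W.preserving.iterate i).measurable (W.measurableSet_base n)

theorem measurableSet_biUnion_level (n : ℕ) (D : Finset ℕ) :
    MeasurableSet (⋃ i ∈ D, W.level n i) :=
  Finset.measurableSet_biUnion _ fun _ _ => W.measurableSet_level _ _

theorem measureReal_level (n i : ℕ) : μ.real (W.level n i) = W.width n :=
  (W.preserving.iterate i).measureReal_preimage (W.measurableSet_base n).nullMeasurableSet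

theorem I_subset {m n : ℕ} (hmn : m ≤ n) : W.I m n ⊆ Finset.range (W.h n) := fun i hi => by
  have := W.I_add_le m n hmn i hi
  have := W.h_pos m
  exact Finset.mem_range.2 (by omega)

theorem ae_mem_biUnion_level_iff {n i : ℕ} (hi : i < W.h n) {D : Finset ℕ}
    (hD : D ⊆ Finset.range (W.h n)) :
    ∀ᵐ x ∂μ, x ∈ W.level n i → (x ∈ ⋃ j ∈ D, W.level n j ↔ i ∈ D) := by
  have hdisj : ∀ j ∈ D, ∀ᵐ x ∂μ, i ≠ j → x ∉ W.level n i ∩ W.level n j := fun j hj => by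
    by_cases hij : i = j
    · simp [hij]
    · filter_upwards [measure_eq_zero_iff_ae_notMem.1 (W.levels_disjoint n i j hi
        (Finset.mem_range.1 (hD hj)) hij)] with x hx _ using hx
  filter_upwards [(Finset.eventually_all D).2 hdisj] with x hx hxi
  simp only [mem_iUnion, exists_prop]
  refine ⟨fun ⟨j, hj, hxj⟩ => ?_, fun hiD => ⟨i, hiD, hxi⟩⟩
  by_contra hiD
  exact hx j hj (fun hij => hiD (hij ▸ hj)) ⟨hxi, hxj⟩

theorem ae_mem_base_iff {m n i : ℕ} (hmn : m ≤ n) (hi : i < W.h n) :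
    ∀ᵐ x ∂μ, x ∈ W.level n i → (x ∈ W.B m ↔ i ∈ W.I m n) := by
  filter_upwards [W.ae_mem_biUnion_level_iff hi (W.I_subset hmn),
    (W.refine_base m n hmn).mem_iff] with x hx hBx hxi
  exact hBx.trans (hx hxi)

theorem level_refine {m n : ℕ} (hmn : m ≤ n) (a : ℕ) :
    W.level m a =ᵐ[μ] ⋃ i ∈ W.I m n, W.level n (i + a) := by
  refine ((W.preserving.iterate a).quasiMeasurePreserving.preimage_ae_eq
    (W.refine_base m n hmn)).trans (EventuallyEq.of_eq ?_)
  simp only [preimage_iUnion, level, ← preimage_comp, ← Function.iterate_add]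
  rfl

theorem biUnion_level_refine {m n : ℕ} (hmn : m ≤ n) (D : Finset ℕ) :
    ⋃ a ∈ D, W.level m a =ᵐ[μ]
      ⋃ i ∈ D.biUnion fun a => (W.I m n).image (· + a), W.level n i := by
  refine (Finset.eventuallyEq_iUnion D fun a _ => W.level_refine hmn a).trans
    (EventuallyEq.of_eq ?_)
  rw [Finset.set_biUnion_biUnion]
  simp only [Finset.set_biUnion_finset_image]
  rfl

theorem eventually_exists_approx {A : Set X} (hA : MeasurableSet A) {ε : ℝ} (hε : 0 < ε) :
    ∀ᶠ n in atTop, ∃ D ⊆ Finset.range (W.h n),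
      μ.real (symmDiff A (⋃ i ∈ D, W.level n i)) < ε := by
  obtain ⟨m, D, hD, hlt⟩ := W.dense A hA ε hε
  filter_upwards [eventually_ge_atTop m] with n hmn
  refine ⟨D.biUnion fun a => (W.I m n).image (· + a), fun j hj => ?_, ?_⟩
  · simp only [Finset.mem_biUnion, Finset.mem_image] at hj
    obtain ⟨a, ha, i, hi, rfl⟩ := hj
    have := W.I_add_le m n hmn i hi
    have := Finset.mem_range.1 (hD ha)
    exact Finset.mem_range.2 (by omega)
  · refine lt_of_eq_of_lt (measureReal_congr ?_) hlt
    exact (ae_eq_refl A).symmDiff (W.biUnion_level_refine hmn D).symm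

theorem measureReal_inter_level_of_preimage_eq {A : Set X} (hA : MeasurableSet A)
    (hinv : W.S ⁻¹' A = A) (n i : ℕ) : μ.real (A ∩ W.level n i) = μ.real (A ∩ W.B n) := by
  rw [← (W.preserving.iterate i).measureReal_preimage
    (hA.inter (W.measurableSet_base n)).nullMeasurableSet, preimage_inter, ← level,
    preimage_iterate_eq, Function.iterate_fixed hinv]

variable [IsFiniteMeasure μ]

theorem width_pos (n : ℕ) : 0 < W.width n :=
  ENNReal.toReal_pos (W.base_ne_zero n) (measure_ne_top _ _)

theorem measureReal_inter_biUnion_level {n : ℕ} {A : Set X} (hA : MeasurableSet A)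
    {D : Finset ℕ} (hD : D ⊆ Finset.range (W.h n)) :
    μ.real (A ∩ ⋃ i ∈ D, W.level n i) = ∑ i ∈ D, μ.real (A ∩ W.level n i) := by
  rw [inter_iUnion₂]
  refine measureReal_biUnion_finset₀ (fun i hi j hj hij => ?_) fun i _ =>
    (hA.inter (W.measurableSet_level n i)).nullMeasurableSet
  exact (W.levels_disjoint n i j (Finset.mem_range.1 (hD hi)) (Finset.mem_range.1 (hD hj))
    hij).mono inter_subset_right inter_subset_right

theorem measureReal_biUnion_level {n : ℕ} {D : Finset ℕ} (hD : D ⊆ Finset.range (W.h n)) :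
    μ.real (⋃ i ∈ D, W.level n i) = D.card * W.width n := by
  simpa [measureReal_level] using W.measureReal_inter_biUnion_level .univ hD

theorem card_mul_le {n : ℕ} {A : Set X} (hA : MeasurableSet A) {D : Finset ℕ}
    (hD : D ⊆ Finset.range (W.h n)) {t : ℝ} (ht : ∀ i ∈ D, t ≤ μ.real (A ∩ W.level n i)) :
    D.card * t ≤ μ.real A := by
  rw [← nsmul_eq_mul]
  refine (Finset.card_nsmul_le_sum _ _ _ ht).trans ?_
  rw [← W.measureReal_inter_biUnion_level hA hD]
  exact measureReal_mono inter_subset_left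

theorem measureReal_le_sum_level {n : ℕ} {A : Set X} (hA : MeasurableSet A) :
    μ.real A ≤
      ∑ i ∈ Finset.range (W.h n), μ.real (A ∩ W.level n i) + μ.real (W.tower n)ᶜ := by
  rw [← W.measureReal_inter_biUnion_level hA subset_rfl, ← tower]
  refine (measureReal_mono fun x hx => ?_).trans (measureReal_union_le _ _)
  by_cases hxn : x ∈ W.tower n
  · exact Or.inl ⟨hx, hxn⟩
  · exact Or.inr hxn

theorem width_eq_card_mul {m n : ℕ} (hmn : m ≤ n) :
    W.width m = (W.I m n).card * W.width n := by
  rw [← W.measureReal_biUnion_level (W.I_subset hmn)]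
  exact measureReal_congr (W.refine_base m n hmn)

theorem card_I_pos {m n : ℕ} (hmn : m ≤ n) : (0 : ℝ) < (W.I m n).card :=
  pos_of_mul_pos_left (W.width_eq_card_mul hmn ▸ W.width_pos m) (W.width_pos n).le

theorem eventually_compl_tower_lt {ε : ℝ} (hε : 0 < ε) :
    ∀ᶠ n in atTop, μ.real (W.tower n)ᶜ < ε := by
  filter_upwards [W.eventually_exists_approx .univ hε] with n ⟨D, hD, hlt⟩
  refine (measureReal_mono fun x hx => ?_).trans_lt hlt
  exact Or.inl ⟨mem_univ x, fun hxD => hx (biUnion_subset_biUnion_left hD hxD)⟩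

theorem sum_min_inter_level_le {n : ℕ} {A : Set X} (hA : MeasurableSet A) {D : Finset ℕ}
    (hD : D ⊆ Finset.range (W.h n)) :
    ∑ i ∈ Finset.range (W.h n),
        min (μ.real (A ∩ W.level n i)) (W.width n - μ.real (A ∩ W.level n i)) ≤
      μ.real (symmDiff A (⋃ i ∈ D, W.level n i)) := by
  have hmeas := hA.symmDiff (W.measurableSet_biUnion_level n D)
  refine (Finset.sum_le_sum fun i hi => ?_).trans
    ((W.measureReal_inter_biUnion_level hmeas subset_rfl).symm.trans_le
      (measureReal_mono inter_subset_left))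
  have hlevel := W.ae_mem_biUnion_level_iff (Finset.mem_range.1 hi) hD
  by_cases hiD : i ∈ D
  · refine (min_le_right _ _).trans ?_
    have hsplit := measureReal_inter_add_sdiff (μ := μ) (s := W.level n i) hA
    rw [W.measureReal_level, inter_comm] at hsplit
    rw [← hsplit, add_sub_cancel_left]
    refine measureReal_mono_ae ?_
    filter_upwards [hlevel] with x hx hxi
    exact ⟨Or.inr ⟨(hx hxi.1).2 hiD, hxi.2⟩, hxi.1⟩
  · refine (min_le_left _ _).trans (measureReal_mono_ae ?_)
    filter_upwards [hlevel] with x hx hxi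
    exact ⟨Or.inl ⟨hxi.1, fun hxD => hiD ((hx hxi.2).1 hxD)⟩, hxi.2⟩

end Towers

section Probability

variable {X : Type*} [MeasurableSpace X] {μ : Measure X} [IsProbabilityMeasure μ]
  (W : TowerSystem μ)

theorem h_mul_width_add (n : ℕ) : W.h n * W.width n + μ.real (W.tower n)ᶜ = 1 := by
  have h := W.measureReal_biUnion_level (n := n) subset_rfl
  rw [Finset.card_range] at h
  rw [← h, ← tower, measureReal_add_measureReal_compl, probReal_univ]
  exact W.measurableSet_biUnion_level n _

theorem h_mul_width_le_one (n : ℕ) : W.h n * W.width n ≤ 1 :=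
  (le_add_of_nonneg_right measureReal_nonneg).trans_eq (W.h_mul_width_add n)

theorem width_le (n : ℕ) : W.width n ≤ (1 / 2) ^ n := by
  rw [one_div_pow, le_div_iff₀' (by positivity)]
  refine le_trans ?_ (W.h_mul_width_le_one n)
  exact mul_le_mul_of_nonneg_right (mod_cast W.two_pow_le n) (W.width_pos n).le

theorem eventually_width_lt {ε : ℝ} (hε : 0 < ε) : ∀ᶠ n in atTop, W.width n < ε := by
  filter_upwards [(tendsto_pow_atTop_nhds_zero_of_lt_one (by norm_num) (by norm_num :
    (1 / 2 : ℝ) < 1)).eventually_lt_const hε] with n hn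
  exact (W.width_le n).trans_lt hn

theorem measureReal_le_add_compl_tower {n : ℕ} {A : Set X} (hA : MeasurableSet A)
    {D : Finset ℕ} (hD : D ⊆ Finset.range (W.h n)) {η : ℝ} (hη : 0 ≤ η)
    (h : ∀ i < W.h n, i ∉ D → μ.real (A ∩ W.level n i) ≤ η * W.width n) :
    μ.real A ≤ D.card * W.width n + η + μ.real (W.tower n)ᶜ := by
  refine (W.measureReal_le_sum_level hA).trans (add_le_add_left ?_ _)
  have hle : ∀ i ∈ Finset.range (W.h n), μ.real (A ∩ W.level n i) ≤
      (if i ∈ D then W.width n else 0) + η * W.width n := fun i hi => by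
    split_ifs with hiD
    · refine (measureReal_mono inter_subset_right).trans ?_
      rw [W.measureReal_level]
      exact le_add_of_nonneg_right (mul_nonneg hη (W.width_pos n).le)
    · rw [zero_add]
      exact h i (Finset.mem_range.1 hi) hiD
  refine (Finset.sum_le_sum hle).trans ?_
  rw [Finset.sum_add_distrib, Finset.sum_ite_mem, Finset.inter_eq_right.2 hD, Finset.sum_const,
    Finset.sum_const, Finset.card_range, nsmul_eq_mul, nsmul_eq_mul, mul_left_comm]
  exact add_le_add_right (mul_le_of_le_one_right hη (W.h_mul_width_le_one n)) _

/- All levels of a tower meet an invariant set `A` in the same measure `β`, so approximating `A` by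
unions of levels forces `β` to be close to `0` or to the width. -/
theorem min_measureReal_le_of_preimage_eq {A : Set X} (hA : MeasurableSet A)
    (hinv : W.S ⁻¹' A = A) {ε : ℝ} (hε : 0 < ε) : min (μ.real A) (1 - μ.real A) ≤ ε := by
  obtain ⟨n, ⟨D, hD, happrox⟩, hcompl⟩ := ((W.eventually_exists_approx hA
    (half_pos hε)).and (W.eventually_compl_tower_lt (half_pos hε))).exists
  have hmin := W.sum_min_inter_level_le hA hD
  have hlower := (W.measureReal_inter_biUnion_level (n := n) hA subset_rfl).symm.trans_le
    (measureReal_mono inter_subset_left)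
  have hupper := W.measureReal_le_sum_level (n := n) hA
  simp only [W.measureReal_inter_level_of_preimage_eq hA hinv, Finset.sum_const,
    Finset.card_range, nsmul_eq_mul] at hmin hlower hupper
  have htotal := W.h_mul_width_add n
  rcases le_total (μ.real (A ∩ W.B n)) (W.width n - μ.real (A ∩ W.B n)) with hle | hle
  · rw [min_eq_left hle] at hmin
    exact (min_le_left _ _).trans (by linarith)
  · rw [min_eq_right hle, mul_sub] at hmin
    exact (min_le_right _ _).trans (by linarith)

theorem ergodic : Ergodic W.S μ where
  toMeasurePreserving := W.preserving
  aeconst_set {A} hA hinv := by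
    have hmin : min (μ.real A) (1 - μ.real A) ≤ 0 := le_of_forall_gt_imp_ge_of_dense
      fun ε hε => W.min_measureReal_le_of_preimage_eq hA hinv hε
    rw [eventuallyConst_set']
    rcases min_le_iff.1 hmin with hzero | hone
    · refine Or.inl (ae_eq_empty.2 ?_)
      rw [← measureReal_eq_zero_iff]
      exact hzero.antisymm measureReal_nonneg
    · refine Or.inr (ae_eq_univ.2 ?_)
      rw [← measureReal_eq_zero_iff, probReal_compl_eq_one_sub hA]
      exact hone.antisymm (sub_nonneg.2 measureReal_le_one)

end Probability

end TowerSystem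

theorem exists_sub_le_of_sum_min_le {ι : Type*} [Fintype ι] {β : ι → ℝ} {w θ : ℝ}
    (hβ : ∀ c, 0 ≤ β c) (hsum : ∑ c, β c = w) (hw : 0 < w) (hθ : θ < 1)
    (h : ∑ c, min (β c) (w - β c) ≤ θ * w) : ∃ c, w - β c ≤ θ * w := by
  have hβw (c : ι) : β c ≤ w :=
    hsum ▸ Finset.single_le_sum (fun c _ => hβ c) (Finset.mem_univ c)
  have hmin (c : ι) : 0 ≤ min (β c) (w - β c) := le_min (hβ c) (sub_nonneg.2 (hβw c))
  obtain ⟨c, hc⟩ : ∃ c, w - β c < β c := by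
    by_contra! hle
    rw [Finset.sum_congr rfl fun c _ => min_eq_left (hle c), hsum] at h
    exact h.not_gt (mul_lt_of_lt_one_left hw hθ)
  refine ⟨c, ?_⟩
  rw [← min_eq_right hc.le]
  exact (Finset.single_le_sum (fun c _ => hmin c) (Finset.mem_univ c)).trans h

namespace TowerSystem

section Concentration

variable {X : Type*} [MeasurableSpace X] {μ : Measure X} (W : TowerSystem μ) {k : ℕ}
  {f : X → ZMod k}

/-- Up to a proportion `η`, the function `f` takes the value `c` on the base of the stage-`n`
tower. -/
def ConcentratesAt (f : X → ZMod k) (n : ℕ) (η : ℝ) (c : ZMod k) : Prop :=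
  μ.real (W.B n ∩ f ⁻¹' {c}ᶜ) ≤ η * W.width n

variable {W}

theorem ConcentratesAt.measureReal_level_inter_compl_le {n : ℕ} {η : ℝ} {c : ZMod k}
    (hc : W.ConcentratesAt f n η c) (hf : IsEigenfunction μ W.S f) (i : ℕ) :
    μ.real (W.level n i ∩ f ⁻¹' {c + i}ᶜ) ≤ η * W.width n := by
  refine le_of_eq_of_le ?_ hc
  rw [← hf.measureReal_preimage_iterate_inter W.preserving i (W.measurableSet_base n), ← level]
  congr 2
  ext x
  simp [sub_eq_iff_eq_add]

theorem ConcentratesAt.le_measureReal_level_inter [IsFiniteMeasure μ] {n : ℕ} {η : ℝ}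
    {c : ZMod k} (hc : W.ConcentratesAt f n η c) (hf : IsEigenfunction μ W.S f) (i : ℕ) :
    (1 - η) * W.width n ≤ μ.real (W.level n i ∩ f ⁻¹' {c + i}) := by
  have hsplit := measureReal_inter_add_sdiff (μ := μ) (s := W.level n i)
    (hf.measurableSet_preimage {c + i})
  rw [W.measureReal_level, sdiff_eq, ← preimage_compl] at hsplit
  linarith [hc.measureReal_level_inter_compl_le hf i]

theorem measureReal_preimage_inter_level (hf : IsEigenfunction μ W.S f) (n i : ℕ) (c : ZMod k) :
    μ.real (f ⁻¹' {c} ∩ W.level n i) = μ.real (W.B n ∩ f ⁻¹' {c - i}) := by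
  rw [← hf.measureReal_preimage_iterate_inter W.preserving i (W.measurableSet_base n), ← level,
    inter_comm]
  congr 2
  ext x
  simp

theorem h_mul_sum_min_fibre_le [NeZero k] [IsFiniteMeasure μ] (hf : IsEigenfunction μ W.S f)
    {n : ℕ} {δ : ℝ} (h : ∀ c, ∃ D ⊆ Finset.range (W.h n),
      μ.real (symmDiff (f ⁻¹' {c}) (⋃ i ∈ D, W.level n i)) ≤ δ) :
    W.h n * ∑ c, min (μ.real (W.B n ∩ f ⁻¹' {c})) (W.width n - μ.real (W.B n ∩ f ⁻¹' {c})) ≤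
      k * δ := by
  let q : ZMod k → ℝ := fun c =>
    min (μ.real (W.B n ∩ f ⁻¹' {c})) (W.width n - μ.real (W.B n ∩ f ⁻¹' {c}))
  have hfibre (c : ZMod k) : ∑ i ∈ Finset.range (W.h n), q (c - i) ≤ δ := by
    obtain ⟨D, hD, hle⟩ := h c
    simp only [q, ← measureReal_preimage_inter_level hf]
    exact (W.sum_min_inter_level_le (hf.measurableSet_preimage {c}) hD).trans hle
  have hshift (i : ℕ) : ∑ c, q (c - i) = ∑ c, q c := Equiv.sum_comp (Equiv.subRight (i : ZMod k)) q
  have hsum := Finset.sum_le_sum fun c (_ : c ∈ Finset.univ) => hfibre c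
  rw [Finset.sum_comm] at hsum
  simpa only [hshift, Finset.sum_const, Finset.card_range, Finset.card_univ, ZMod.card,
    nsmul_eq_mul] using hsum

theorem concentratesAt_of_width_sub_le [IsFiniteMeasure μ] (hf : IsEigenfunction μ W.S f)
    {n : ℕ} {η : ℝ} {c : ZMod k}
    (h : W.width n - μ.real (W.B n ∩ f ⁻¹' {c}) ≤ η * W.width n) : W.ConcentratesAt f n η c := by
  have hsplit := measureReal_inter_add_sdiff (μ := μ) (s := W.B n) (hf.measurableSet_preimage {c})
  rw [sdiff_eq, ← preimage_compl, ← width] at hsplit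
  unfold ConcentratesAt
  linarith

theorem eventually_exists_concentratesAt [IsProbabilityMeasure μ] [NeZero k]
    (hf : IsEigenfunction μ W.S f) {η : ℝ} (hη : 0 < η) :
    ∀ᶠ n in atTop, ∃ c, W.ConcentratesAt f n η c := by
  let θ : ℝ := min η (1 / 2)
  have hθ : 0 < θ := lt_min hη (by norm_num)
  have hk : (0 : ℝ) < k := mod_cast Nat.pos_of_ne_zero (NeZero.ne k)
  filter_upwards [eventually_all.2 fun c : ZMod k => W.eventually_exists_approx
      (hf.measurableSet_preimage {c}) (show 0 < θ / (2 * k) by positivity),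
    W.eventually_compl_tower_lt (show (0 : ℝ) < 1 / 2 by norm_num)] with n happrox hcompl
  have hwidth := W.width_pos n
  have hmin : ∑ c, min (μ.real (W.B n ∩ f ⁻¹' {c}))
      (W.width n - μ.real (W.B n ∩ f ⁻¹' {c})) ≤ θ * W.width n := by
    refine le_of_mul_le_mul_left ?_ (Nat.cast_pos.2 (W.h_pos n) : (0 : ℝ) < W.h n)
    calc _ ≤ k * (θ / (2 * k)) := h_mul_sum_min_fibre_le hf fun c =>
          (happrox c).imp fun D hD => ⟨hD.1, hD.2.le⟩
      _ = θ * (1 / 2) := by field_simp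
      _ ≤ θ * (W.h n * W.width n) :=
          mul_le_mul_of_nonneg_left (by linarith [W.h_mul_width_add n]) hθ.le
      _ = W.h n * (θ * W.width n) := by ring
  have hsum : ∑ c, μ.real (W.B n ∩ f ⁻¹' {c}) = W.width n := by
    simp only [inter_comm (W.B n), ← measureReal_restrict_apply (hf.measurableSet_preimage _)]
    rw [sum_measureReal_preimage_singleton _ fun c _ => hf.measurableSet_preimage {c}]
    simp [width]
  obtain ⟨c, hc⟩ := exists_sub_le_of_sum_min_le (fun c => measureReal_nonneg) hsum hwidth
    ((min_le_right _ _).trans_lt (by norm_num)) hmin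
  exact ⟨c, concentratesAt_of_width_sub_le hf
    (hc.trans (mul_le_mul_of_nonneg_right (min_le_left _ _) hwidth.le))⟩

end Concentration

section Residues

variable {X : Type*} [MeasurableSpace X] {μ : Measure X} (W : TowerSystem μ)

/-- Condition (IIa): for late `m < n`, all but a small proportion of `W.I m n` lies in one residue
class modulo `k`. -/
def HasReturnResidue (k : ℕ) : Prop :=
  ∀ η : ℝ, 0 < η → ∀ᶠ m in atTop, ∀ n > m, ∃ j < k,
    (((W.I m n).filter fun i => i % k ≠ j).card : ℝ) / (W.I m n).card < η

/-- Condition (IIb): for late `m`, the set `W.I l m` is `ε`-approximated by a union of residue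
classes modulo `k`. -/
def HasResidueApprox (l : ℕ) (ε : ℝ) (k : ℕ) : Prop :=
  ∀ᶠ m in atTop, ∃ D ⊆ Finset.range k,
    ((symmDiff ((Finset.range (W.h m + 1)).filter fun i => i % k ∈ D) (W.I l m)).card : ℝ)
      / (W.I l m).card < ε

open Classical in
/-- The indices of the levels of the stage-`m` tower at which the predicate `P` differs from
membership in `W.I l m`. -/
noncomputable def misclassified (l m : ℕ) (P : ℕ → Prop) : Finset ℕ :=
  (Finset.range (W.h m)).filter fun i => ¬(P i ↔ i ∈ W.I l m)

theorem misclassified_subset (l m : ℕ) (P : ℕ → Prop) :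
    W.misclassified l m P ⊆ Finset.range (W.h m) := by
  classical exact Finset.filter_subset _ _

theorem mem_misclassified {l m i : ℕ} {P : ℕ → Prop} :
    i ∈ W.misclassified l m P ↔ i < W.h m ∧ ¬(P i ↔ i ∈ W.I l m) := by
  simp only [misclassified, Finset.mem_filter, Finset.mem_range]

theorem card_misclassified_le (l m : ℕ) (P : ℕ → Prop) [DecidablePred P] :
    (W.misclassified l m P).card ≤
      (symmDiff ((Finset.range (W.h m + 1)).filter P) (W.I l m)).card := by
  refine Finset.card_le_card fun i hi => ?_
  rw [mem_misclassified] at hi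
  rw [Finset.mem_symmDiff, Finset.mem_filter, Finset.mem_range]
  have := Nat.lt_succ_of_lt hi.1
  tauto

/- The index `W.h m`, which is not that of a level, is allowed on the left. -/
theorem card_symmDiff_le {l m : ℕ} (hlm : l ≤ m) (P : ℕ → Prop) [DecidablePred P] :
    (symmDiff ((Finset.range (W.h m + 1)).filter P) (W.I l m)).card ≤
      (W.misclassified l m P).card + 1 := by
  refine (Finset.card_le_card (t := insert (W.h m) (W.misclassified l m P))
    fun i hi => ?_).trans (Finset.card_insert_le _ _)
  rw [Finset.mem_symmDiff, Finset.mem_filter, Finset.mem_range_succ_iff] at hi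
  rw [Finset.mem_insert, mem_misclassified]
  have hIlt : i ∈ W.I l m → i < W.h m := fun hiI => Finset.mem_range.1 (W.I_subset hlm hiI)
  by_cases hih : i = W.h m
  · exact Or.inl hih
  · have : i ≤ W.h m ↔ i < W.h m := ⟨fun hle => lt_of_le_of_ne hle hih, le_of_lt⟩
    tauto

variable {W} {k : ℕ} {f : X → ZMod k}

theorem ae_mem_symmDiff_iff {l m i : ℕ} (hlm : l ≤ m) (hi : i < W.h m) (E : Set (ZMod k))
    (e : ZMod k) : ∀ᵐ x ∂μ, x ∈ W.level m i ∩ f ⁻¹' {e} →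
      (x ∈ symmDiff (W.B l) (f ⁻¹' E) ↔ ¬(e ∈ E ↔ i ∈ W.I l m)) := by
  filter_upwards [W.ae_mem_base_iff hlm hi] with x hx ⟨hxi, hxe⟩
  rw [mem_symmDiff, hx hxi, mem_preimage, (hxe : f x = e)]
  tauto

theorem card_misclassified_mul_le [IsFiniteMeasure μ] (hf : IsEigenfunction μ W.S f) {l m : ℕ}
    (hlm : l ≤ m) {η : ℝ} {c : ZMod k} (hc : W.ConcentratesAt f m η c) (E : Set (ZMod k)) :
    (W.misclassified l m fun i => c + i ∈ E).card * ((1 - η) * W.width m) ≤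
      μ.real (symmDiff (W.B l) (f ⁻¹' E)) := by
  refine W.card_mul_le ((W.measurableSet_base l).symmDiff (hf.measurableSet_preimage E))
    (W.misclassified_subset l m _) fun i hi => (hc.le_measureReal_level_inter hf i).trans ?_
  rw [mem_misclassified] at hi
  refine measureReal_mono_ae ?_
  filter_upwards [ae_mem_symmDiff_iff (f := f) hlm hi.1 E (c + i)] with x hx hxi
  exact ⟨(hx hxi).2 hi.2, hxi.1⟩

theorem measureReal_symmDiff_le [IsProbabilityMeasure μ] (hf : IsEigenfunction μ W.S f)
    {l m : ℕ} (hlm : l ≤ m) {η : ℝ} (hη : 0 ≤ η) {c : ZMod k} (hc : W.ConcentratesAt f m η c)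
    (E : Set (ZMod k)) :
    μ.real (symmDiff (W.B l) (f ⁻¹' E)) ≤
      (W.misclassified l m fun i => c + i ∈ E).card * W.width m + η + μ.real (W.tower m)ᶜ := by
  refine W.measureReal_le_add_compl_tower
    ((W.measurableSet_base l).symmDiff (hf.measurableSet_preimage E))
    (W.misclassified_subset l m _) hη fun i hi hmis => le_trans (measureReal_mono_ae ?_)
      (hc.measureReal_level_inter_compl_le hf i)
  rw [mem_misclassified] at hmis
  filter_upwards [ae_mem_symmDiff_iff (f := f) hlm hi E (c + i)] with x hx ⟨hxE, hxi⟩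
  exact ⟨hxi, fun hfx => hmis ⟨hi, (hx ⟨hxi, hfx⟩).1 hxE⟩⟩

theorem hasReturnResidue_of_isEigenfunction [IsProbabilityMeasure μ] [NeZero k]
    (hf : IsEigenfunction μ W.S f) : W.HasReturnResidue k := fun η hη => by
  let θ : ℝ := min (η / 4) (1 / 2)
  have hθ : 0 < θ := lt_min (by positivity) (by norm_num)
  obtain ⟨N, hN⟩ := eventually_atTop.1 (eventually_exists_concentratesAt hf hθ)
  filter_upwards [eventually_ge_atTop N] with m hm n hmn
  obtain ⟨c, hc⟩ := hN m hm
  obtain ⟨d, hd⟩ := hN n (hm.trans hmn.le)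
  refine ⟨(c - d).val, ZMod.val_lt _, ?_⟩
  set J := (W.I m n).filter fun i => i % k ≠ (c - d).val
  have hJc : J.card * ((1 - θ) * W.width n) ≤ θ * W.width m := by
    refine (W.card_mul_le ((W.measurableSet_base m).inter (hf.measurableSet_preimage {c}ᶜ))
      ((Finset.filter_subset _ _).trans (W.I_subset hmn.le)) fun i hi =>
        (hd.le_measureReal_level_inter hf i).trans (measureReal_mono_ae ?_)).trans hc
    rw [Finset.mem_filter] at hi
    filter_upwards [W.ae_mem_base_iff hmn.le (Finset.mem_range.1 (W.I_subset hmn.le hi.1))]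
      with x hx ⟨hxi, hfx⟩
    refine ⟨⟨(hx hxi).2 hi.1, fun hfc => hi.2 ?_⟩, hxi⟩
    rw [← (hfc : f x = c), (hfx : f x = d + i), add_sub_cancel_left, ZMod.val_natCast]
  rw [W.width_eq_card_mul hmn.le] at hJc
  have hI := W.card_I_pos hmn.le
  have hJI : (J.card : ℝ) * (1 - θ) ≤ θ * (W.I m n).card :=
    le_of_mul_le_mul_right (by linarith) (W.width_pos n)
  have hθη : θ ≤ η / 4 := min_le_left _ _
  have hθ_half : θ ≤ 1 / 2 := min_le_right _ _
  rw [div_lt_iff₀ hI]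
  nlinarith [Nat.cast_nonneg (α := ℝ) J.card]

theorem hasResidueApprox_of_measureReal_lt [IsProbabilityMeasure μ] [NeZero k]
    (hf : IsEigenfunction μ W.S f) {l : ℕ} {E : Set (ZMod k)} {ε : ℝ} (hε : 0 < ε)
    (hE : μ.real (symmDiff (W.B l) (f ⁻¹' E)) < ε / 4 * W.width l) :
    W.HasResidueApprox l ε k := by
  classical
  filter_upwards [eventually_exists_concentratesAt hf (show (0 : ℝ) < 1 / 2 by norm_num),
    W.eventually_width_lt (mul_pos (half_pos hε) (W.width_pos l)), eventually_ge_atTop l]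
    with m ⟨c, hc⟩ hwidth hlm
  let D : Finset ℕ := (Finset.range k).filter fun d : ℕ => c + (d : ZMod k) ∈ E
  have hD (i : ℕ) : i % k ∈ D ↔ c + (i : ZMod k) ∈ E := by
    simp [D, Nat.mod_lt _ (NeZero.pos k)]
  refine ⟨D, Finset.filter_subset _ _, ?_⟩
  have hcard := W.card_symmDiff_le hlm fun i => i % k ∈ D
  rify at hcard
  have hmis := (card_misclassified_mul_le hf hlm hc E).trans hE.le
  simp only [← hD] at hmis
  rw [div_lt_iff₀ (W.card_I_pos hlm)]
  refine lt_of_mul_lt_mul_right ?_ (W.width_pos m).le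
  rw [mul_assoc, ← W.width_eq_card_mul hlm]
  nlinarith [mul_le_mul_of_nonneg_right hcard (W.width_pos m).le]

theorem exists_measureReal_le_of_hasResidueApprox [IsProbabilityMeasure μ] [NeZero k]
    (hf : IsEigenfunction μ W.S f) {l : ℕ} {ε : ℝ} (hε : 0 < ε)
    (h : W.HasResidueApprox l ε k) :
    ∃ E : Set (ZMod k), μ.real (symmDiff (W.B l) (f ⁻¹' E)) ≤ 2 * ε * W.width l := by
  have hη : 0 < ε / 2 * W.width l := mul_pos (half_pos hε) (W.width_pos l)
  obtain ⟨m, ⟨⟨⟨D, -, hD⟩, c, hc⟩, hcompl⟩, hlm⟩ := (((h.and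
    (eventually_exists_concentratesAt hf hη)).and (W.eventually_compl_tower_lt hη)).and
      (eventually_ge_atTop l)).exists
  refine ⟨{e | (e - c).val ∈ D}, (measureReal_symmDiff_le hf hlm hη.le hc _).trans ?_⟩
  have hmod (i : ℕ) : c + (i : ZMod k) ∈ {e | (e - c).val ∈ D} ↔ i % k ∈ D := by
    rw [mem_ofPred, add_sub_cancel_left, ZMod.val_natCast]
  simp only [hmod]
  have hcard := W.card_misclassified_le l m fun i => i % k ∈ D
  rify at hcard
  rw [div_lt_iff₀ (W.card_I_pos hlm)] at hD
  have hmis := mul_le_mul_of_nonneg_right (hcard.trans hD.le) (W.width_pos m).le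
  rw [mul_assoc, ← W.width_eq_card_mul hlm] at hmis
  linarith

theorem eventually_dvd_of_measureReal_le [IsProbabilityMeasure μ] [NeZero k]
    (hf : IsEigenfunction μ W.S f) :
    ∀ᶠ l in atTop, ∀ (k' : ℕ) (g : X → ZMod k') (E : Set (ZMod k')), IsEigenfunction μ W.S g →
      μ.real (symmDiff (W.B l) (g ⁻¹' E)) ≤ 1 / 5 * W.width l → k ∣ k' := by
  filter_upwards [eventually_exists_concentratesAt hf (show (0 : ℝ) < 1 / 10 by norm_num)]
    with l ⟨c, hc⟩ k' g E hg hE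
  have hbase := measureReal_inter_add_sdiff (μ := μ) (s := W.B l) (hf.measurableSet_preimage {c})
  rw [sdiff_eq, ← preimage_compl, ← width] at hbase
  have hoff : μ.real (g ⁻¹' E ∩ f ⁻¹' {c}ᶜ) ≤
      μ.real (symmDiff (W.B l) (g ⁻¹' E)) + μ.real (W.B l ∩ f ⁻¹' {c}ᶜ) := by
    refine (measureReal_mono fun x hx => ?_).trans (measureReal_union_le _ _)
    by_cases hxB : x ∈ W.B l
    · exact Or.inr ⟨hxB, hx.2⟩
    · exact Or.inl (Or.inr ⟨hx.1, hxB⟩)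
  have hon : μ.real (W.B l ∩ f ⁻¹' {c}) ≤
      μ.real (symmDiff (W.B l) (g ⁻¹' E)) + μ.real (g ⁻¹' E ∩ f ⁻¹' {c}) := by
    refine (measureReal_mono fun x hx => ?_).trans (measureReal_union_le _ _)
    by_cases hxE : x ∈ g ⁻¹' E
    · exact Or.inr ⟨hxE, hx.2⟩
    · exact Or.inl (Or.inl ⟨hx.1, hxE⟩)
  refine hf.dvd_of_measureReal_lt W.preserving hg (E := E) (c := c) ?_
  unfold ConcentratesAt at hc
  linarith [W.width_pos l]

end Residues

section LevelIndex

variable {X : Type*} [MeasurableSpace X] {μ : Measure X} (W : TowerSystem μ)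

/-- The index of the level of the stage-`n` tower that contains a given point; it is `0` outside
the tower, and it is only meaningful where the levels do not overlap, that is almost everywhere. -/
noncomputable def levelIndex (n : ℕ) (x : X) : ℕ :=
  ∑ i ∈ Finset.range (W.h n), (W.level n i).indicator (fun _ => i) x

theorem measurable_levelIndex (n : ℕ) : Measurable (W.levelIndex n) :=
  Finset.measurable_sum _ fun i _ => measurable_const.indicator (W.measurableSet_level n i)

theorem ae_levelIndex_eq {n i : ℕ} (hi : i < W.h n) :
    ∀ᵐ x ∂μ, x ∈ W.level n i → W.levelIndex n x = i := by
  filter_upwards [W.ae_mem_biUnion_level_iff hi (Finset.erase_subset i _)] with x hx hxi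
  rw [levelIndex, Finset.sum_eq_single_of_mem i (Finset.mem_range.2 hi), indicator_of_mem hxi]
  intro j hj hji
  refine indicator_of_notMem (fun hxj => ?_) _
  exact Finset.notMem_erase i _
    ((hx hxi).1 (mem_biUnion (Finset.mem_erase.2 ⟨hji, hj⟩) hxj))

theorem ae_levelIndex_eq_add {m n a : ℕ} (hmn : m ≤ n) (ha : a < W.h m) :
    ∀ᵐ x ∂μ, x ∈ W.level m a →
      ∃ i ∈ W.I m n, x ∈ W.level n (i + a) ∧ W.levelIndex n x = i + W.levelIndex m x := by
  have hindex : ∀ i ∈ W.I m n, ∀ᵐ x ∂μ, x ∈ W.level n (i + a) → W.levelIndex n x = i + a :=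
    fun i hi => W.ae_levelIndex_eq (by have := W.I_add_le m n hmn i hi; omega)
  filter_upwards [(Finset.eventually_all _).2 hindex, W.ae_levelIndex_eq ha,
    (W.level_refine hmn a).mem_iff] with x hxn hxm hrefine hxa
  obtain ⟨i, hi, hxi⟩ := mem_iUnion₂.1 (hrefine.1 hxa)
  exact ⟨i, hi, hxi, by rw [hxn i hi hxi, hxm hxa]⟩

variable [IsProbabilityMeasure μ] {k : ℕ}

theorem measureReal_levelIndex_sub_ne_le {m n j : ℕ} (hmn : m ≤ n) {η : ℝ} (hη : 0 ≤ η)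
    (hj : (((W.I m n).filter fun i => i % k ≠ j).card : ℝ) / (W.I m n).card ≤ η) :
    μ.real {x | (W.levelIndex n x : ZMod k) - W.levelIndex m x ≠ j} ≤
      η + μ.real (W.tower m)ᶜ := by
  have hmeas : MeasurableSet {x | (W.levelIndex n x : ZMod k) - W.levelIndex m x ≠ j} :=
    ((Measurable.of_discrete (f := fun p : ℕ × ℕ => (p.1 : ZMod k) - p.2)).comp
      ((W.measurable_levelIndex n).prodMk (W.measurable_levelIndex m))
        (measurableSet_singleton (j : ZMod k))).compl
  set J := (W.I m n).filter fun i => i % k ≠ j with hJ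
  have hbound := W.measureReal_le_add_compl_tower (n := m) hmeas (Finset.empty_subset _) hη
  rw [Finset.card_empty, Nat.cast_zero, zero_mul, zero_add] at hbound
  refine hbound fun a ha _ => ?_
  calc
    _ ≤ μ.real (⋃ i ∈ J, W.level n (i + a)) := by
      refine measureReal_mono_ae ?_
      filter_upwards [W.ae_levelIndex_eq_add hmn ha] with x hx ⟨hne, hxa⟩
      obtain ⟨i, hi, hxi, hadd⟩ := hx hxa
      refine mem_biUnion (Finset.mem_filter.2 ⟨hi, fun hij => hne ?_⟩) hxi
      rw [hadd, Nat.cast_add, add_sub_cancel_right, ← hij, ZMod.natCast_mod]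
    _ ≤ J.card * W.width n := by
      refine (measureReal_biUnion_finset_le _ _).trans_eq ?_
      simp only [measureReal_level, Finset.sum_const, nsmul_eq_mul]
    _ ≤ η * W.width m := by
      rw [W.width_eq_card_mul hmn, ← mul_assoc]
      rw [div_le_iff₀ (W.card_I_pos hmn)] at hj
      exact mul_le_mul_of_nonneg_right hj (W.width_pos n).le

variable [NeZero k]

theorem measureReal_levelIndex_map_add_one_ne_le (n : ℕ) :
    μ.real {x | (W.levelIndex n (W.S x) : ZMod k) + 1 ≠ W.levelIndex n x} ≤
      W.width n + μ.real (W.tower n)ᶜ := by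
  have hindex : Measurable fun x => (W.levelIndex n x : ZMod k) :=
    Measurable.of_discrete.comp (W.measurable_levelIndex n)
  have hmeas : MeasurableSet {x | (W.levelIndex n (W.S x) : ZMod k) + 1 ≠ W.levelIndex n x} :=
    (measurableSet_eq_fun ((hindex.comp W.preserving.measurable).add_const 1) hindex).compl
  have hbound := W.measureReal_le_add_compl_tower (n := n) hmeas
    (Finset.singleton_subset_iff.2 (Finset.mem_range.2 (W.h_pos n))) le_rfl
  rw [Finset.card_singleton, Nat.cast_one, one_mul, add_zero] at hbound
  refine hbound fun i hi hi0 => ?_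
  obtain ⟨i, rfl⟩ := Nat.exists_eq_succ_of_ne_zero (Finset.notMem_singleton.1 hi0)
  refine le_of_eq ?_
  rw [zero_mul, measureReal_eq_zero_iff, measure_eq_zero_iff_ae_notMem]
  filter_upwards [W.ae_levelIndex_eq hi,
    W.preserving.quasiMeasurePreserving.ae (W.ae_levelIndex_eq (i.lt_succ_self.trans hi))]
    with x hx hSx ⟨hne, hxi⟩
  have hSxi : W.S x ∈ W.level n i := hxi
  exact hne (by rw [hx hxi, hSx hSxi, Nat.cast_succ])

theorem exists_isEigenfunction_of_hasReturnResidue (h : W.HasReturnResidue k) :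
    ∃ f : X → ZMod k, IsEigenfunction μ W.S f := by
  have hev : ∀ p : ℕ, ∀ᶠ m in atTop, (∀ n > m, ∃ j < k,
      (((W.I m n).filter fun i => i % k ≠ j).card : ℝ) / (W.I m n).card < (1 / 2) ^ p) ∧
      μ.real (W.tower m)ᶜ < (1 / 2) ^ p ∧ W.width m < (1 / 2) ^ p := fun p => by
    have hp : (0 : ℝ) < (1 / 2) ^ p := by positivity
    exact (h _ hp).and ((W.eventually_compl_tower_lt hp).and (W.eventually_width_lt hp))
  obtain ⟨φ, hφ, hsmall⟩ := extraction_forall_of_eventually hev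
  choose j _ hj using fun p => (hsmall p).1 (φ (p + 1)) (hφ p.lt_succ_self)
  -- Subtracting the accumulated residues of the return times makes the level indices at
  -- successive stages agree up to a summable error.
  let g : ℕ → X → ZMod k := fun p x =>
    W.levelIndex (φ p) x - ∑ q ∈ Finset.range p, (j q : ZMod k)
  have hsum : Summable fun p : ℕ => 2 * (1 / 2 : ℝ) ^ p := summable_geometric_two.mul_left 2
  refine exists_isEigenfunction_of_summable W.preserving (g := g) hsum
    (fun p => (Measurable.of_discrete.comp (W.measurable_levelIndex (φ p))).sub_const _)
    (fun p => ?_) fun p => ?_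
  · have hstep := W.measureReal_levelIndex_sub_ne_le (hφ p.lt_succ_self).le (by positivity)
      (hj p).le
    refine (measureReal_mono ?_).trans (hstep.trans (by linarith [(hsmall p).2.1]))
    refine fun x hx heq => hx ?_
    simp only [g, Finset.sum_range_succ, ← heq]
    ring
  · have hmap := W.measureReal_levelIndex_map_add_one_ne_le (k := k) (φ p)
    refine (measureReal_mono ?_).trans (hmap.trans (by linarith [(hsmall p).2]))
    refine fun x hx heq => hx ?_
    simp only [g, ← heq]
    ring

end LevelIndex

end TowerSystem

namespace OdometerSeq

theorem exists_divisorSet_eq {K : Set ℕ} (h_zero : 0 ∉ K) (h_dvd : ∀ a ∈ K, ∀ d, d ∣ a → d ∈ K)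
    (h_dir : ∀ a ∈ K, ∀ b ∈ K, ∃ c ∈ K, a ∣ c ∧ b ∣ c) (h_one : ∃ a ∈ K, 1 < a) :
    ∃ O : OdometerSeq, O.divisorSet = K := by
  have := Encodable.ofCountable {a | a ∈ K ∧ 1 < a}
  have : Inhabited {a | a ∈ K ∧ 1 < a} := ⟨⟨h_one.choose, h_one.choose_spec⟩⟩
  have one_lt_of_dvd : ∀ a c, 1 < a → c ∈ K → a ∣ c → 1 < c := fun a c ha hc hac =>
    ha.trans_le (Nat.le_of_dvd (Nat.pos_of_ne_zero fun h => h_zero (h ▸ hc)) hac)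
  have hdir : Directed (· ∣ ·) ((↑) : {a | a ∈ K ∧ 1 < a} → ℕ) := fun a b => by
    obtain ⟨c, hc, hac, hbc⟩ := h_dir a a.2.1 b b.2.1
    exact ⟨⟨c, hc, one_lt_of_dvd a c a.2.2 hc hac⟩, hac, hbc⟩
  refine ⟨⟨fun n => hdir.sequence _ n, fun n => (hdir.sequence _ n).2.2,
    hdir.sequence_mono_nat⟩, Set.ext fun d => ⟨fun ⟨n, hn⟩ => ?_, fun hd => ?_⟩⟩
  · exact h_dvd _ (hdir.sequence _ n).2.1 d hn
  · obtain ⟨a, haK, ha⟩ := h_one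
    obtain ⟨c, hc, hac, hdc⟩ := h_dir a haK d hd
    exact ⟨_, hdc.trans (hdir.rel_sequence ⟨c, hc, one_lt_of_dvd a c ha hc hac⟩)⟩

variable (O : OdometerSeq)

instance neZero_k (n : ℕ) : NeZero (O.k n) := ⟨(O.k_pos n).ne'⟩

/-- Reduction of residue classes from modulus `O.k n` to the smaller modulus `O.k m`. -/
def reduce {m n : ℕ} (hmn : m ≤ n) : ZMod (O.k n) →+* ZMod (O.k m) :=
  ZMod.castHom (O.dvd_of_le hmn) (ZMod (O.k m))

theorem val_reduce {m n : ℕ} (hmn : m ≤ n) (a : ZMod (O.k n)) :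
    (O.reduce hmn a).val = a.val % O.k m := by
  rw [reduce, ZMod.castHom_apply, ZMod.cast_eq_val, ZMod.val_natCast]

/-- The `n`-th coordinate of a point of the odometer, as a residue class. -/
def coord (n : ℕ) (α : O.Space) : ZMod (O.k n) := α.1 n

theorem val_coord (n : ℕ) (α : O.Space) : (O.coord n α).val = α.1 n :=
  ZMod.val_cast_of_lt (α.2.1 n)

theorem measurable_coord (n : ℕ) : Measurable (O.coord n) :=
  Measurable.of_discrete.comp ((measurable_pi_apply n).comp measurable_subtype_coe)

theorem coord_shift (n : ℕ) (α : O.Space) : O.coord n (O.shift α) = O.coord n α + 1 := by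
  rw [coord, shift, ZMod.natCast_mod, Nat.cast_succ, coord]

theorem reduce_coord {m n : ℕ} (hmn : m ≤ n) (α : O.Space) :
    O.reduce hmn (O.coord n α) = O.coord m α := by
  rw [coord, map_natCast, coord, ← α.2.2 m n hmn, ZMod.natCast_mod]

theorem ext_coord {α β : O.Space} (h : ∀ n, O.coord n α = O.coord n β) : α = β :=
  Subtype.ext (funext fun n => by rw [← O.val_coord, ← O.val_coord, h n])

/-- The sets that depend on a single coordinate; they generate the σ-algebra of the odometer. -/
def cylinders : Set (Set O.Space) :=
  {G | ∃ (n : ℕ) (E : Set (ZMod (O.k n))), G = O.coord n ⁻¹' E}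

theorem isSetAlgebra_cylinders : IsSetAlgebra O.cylinders where
  empty_mem := ⟨0, ∅, rfl⟩
  compl_mem := by
    rintro _ ⟨n, E, rfl⟩
    exact ⟨n, Eᶜ, rfl⟩
  union_mem := by
    rintro _ _ ⟨m, E, rfl⟩ ⟨n, F, rfl⟩
    refine ⟨max m n, O.reduce (le_max_left m n) ⁻¹' E ∪ O.reduce (le_max_right m n) ⁻¹' F, ?_⟩
    ext α
    simp only [preimage_union, mem_union, mem_preimage, reduce_coord]

theorem generateFrom_cylinders :
    (inferInstance : MeasurableSpace O.Space) = MeasurableSpace.generateFrom O.cylinders := by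
  refine le_antisymm ?_ (MeasurableSpace.generateFrom_le ?_)
  · refine measurable_iff_comap_le.1 (@measurable_pi_lambda _ _ _ (_) _ _ fun n t _ => ?_)
    refine MeasurableSpace.measurableSet_generateFrom ⟨n, ZMod.val ⁻¹' t, ?_⟩
    ext α
    rw [mem_preimage, mem_preimage, mem_preimage, val_coord]
  · rintro _ ⟨n, E, rfl⟩
    exact O.measurable_coord n (.of_discrete)

instance : IsProbabilityMeasure O.measure :=
  Measure.isProbabilityMeasure_map O.measurable_ofDigits.aemeasurable

theorem exists_cylinder_approx {G : Set O.Space} (hG : MeasurableSet G) {δ : ℝ} (hδ : 0 < δ) :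
    ∃ (n : ℕ) (E : Set (ZMod (O.k n))), O.measure.real (symmDiff G (O.coord n ⁻¹' E)) < δ := by
  obtain ⟨_, ⟨n, E, rfl⟩, hlt⟩ := (Measure.MeasureDense.of_generateFrom_isSetAlgebra_finite
    (μ := O.measure) O.isSetAlgebra_cylinders O.generateFrom_cylinders).approx G hG
      (measure_ne_top _ _) δ hδ
  exact ⟨n, E, (ENNReal.lt_ofReal_iff_toReal_lt (measure_ne_top _ _)).1 hlt⟩

theorem measure_coord_preimage_singleton (n : ℕ) (c : ZMod (O.k n)) :
    O.measure (O.coord n ⁻¹' {c}) = (O.k n : ENNReal)⁻¹ := by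
  rw [← O.measure_cylinder n c.val (ZMod.val_lt c)]
  congr 1
  ext α
  rw [mem_preimage, mem_singleton_iff, mem_ofPred, ← val_coord, (ZMod.val_injective _).eq_iff]

theorem eq_measure {ν : Measure O.Space} [IsFiniteMeasure ν]
    (h : ∀ n c, ν (O.coord n ⁻¹' {c}) = (O.k n : ENNReal)⁻¹) : ν = O.measure := by
  have hmap (n : ℕ) : ν.map (O.coord n) = O.measure.map (O.coord n) := by
    refine Measure.ext_of_singleton fun c => ?_
    rw [Measure.map_apply (O.measurable_coord n) (measurableSet_singleton c),
      Measure.map_apply (O.measurable_coord n) (measurableSet_singleton c), h,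
      measure_coord_preimage_singleton]
  have hcyl : ∀ G ∈ O.cylinders, ν G = O.measure G := by
    rintro _ ⟨n, E, rfl⟩
    rw [← Measure.map_apply (O.measurable_coord n) .of_discrete,
      ← Measure.map_apply (O.measurable_coord n) .of_discrete, hmap]
  exact ext_of_generate_finite _ O.generateFrom_cylinders
    (fun _ hs _ ht _ => O.isSetAlgebra_cylinders.inter_mem hs ht) hcyl
    (hcyl _ O.isSetAlgebra_cylinders.univ_mem)

/-- The point of the odometer with a given coherent sequence of coordinates. -/
def ofCoherent (a : ∀ n, ZMod (O.k n)) (h : ∀ n, O.reduce n.le_succ (a (n + 1)) = a n) :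
    O.Space :=
  ⟨fun n => (a n).val, fun n => ZMod.val_lt _, fun m n hmn => by
    induction n, hmn using Nat.le_induction with
    | base => exact Nat.mod_eq_of_lt (ZMod.val_lt _)
    | succ n hmn ih =>
      rw [← ih]
      beta_reduce
      rw [← h n, val_reduce, Nat.mod_mod_of_dvd _ (O.dvd_of_le hmn)]⟩

theorem coord_ofCoherent (a : ∀ n, ZMod (O.k n))
    (h : ∀ n, O.reduce n.le_succ (a (n + 1)) = a n) (n : ℕ) :
    O.coord n (O.ofCoherent a h) = a n := by
  rw [coord, ofCoherent, ZMod.natCast_zmod_val]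

theorem measurable_of_measurable_coord {X : Type*} [MeasurableSpace X] {Φ : X → O.Space}
    (h : ∀ n, Measurable fun x => O.coord n (Φ x)) : Measurable Φ := by
  refine Measurable.subtype_mk (f := fun x => (Φ x).1) (measurable_pi_lambda _ fun n => ?_)
  simp only [← val_coord]
  exact Measurable.of_discrete.comp (h n)

instance : MeasurableEq O.Space where
  measurableSet_diagonal := by
    have h : diagonal O.Space = ⋂ n, {p | O.coord n p.1 = O.coord n p.2} := by
      ext p
      rw [mem_diagonal_iff, mem_iInter]
      exact ⟨fun hp n => congrArg (O.coord n) hp, O.ext_coord⟩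
    rw [h]
    exact MeasurableSet.iInter fun n => measurableSet_eq_fun
      ((O.measurable_coord n).comp measurable_fst) ((O.measurable_coord n).comp measurable_snd)

section Factor

variable {X : Type*} [MeasurableSpace X] {μ : Measure X} {S : X → X}

theorem exists_coherent_ae (hS : Ergodic S μ)
    (h : ∀ n, ∃ f : X → ZMod (O.k n), IsEigenfunction μ S f) :
    ∃ a : ∀ n, X → ZMod (O.k n), (∀ n, IsEigenfunction μ S (a n)) ∧
      ∀ n, ∀ᵐ x ∂μ, O.reduce n.le_succ (a (n + 1) x) = a n x := by
  choose g hg using h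
  choose lift hlift hcast using fun (n : ℕ) (f : {f // IsEigenfunction μ S f}) =>
    f.2.exists_lift hS (O.dvd_succ n) (hg (n + 1))
  let a : ∀ n, {f : X → ZMod (O.k n) // IsEigenfunction μ S f} :=
    fun n => Nat.rec ⟨g 0, hg 0⟩ (fun n f => ⟨lift n f, hlift n f⟩) n
  exact ⟨fun n => (a n).1, fun n => (a n).2, fun n => hcast n (a n)⟩

theorem exists_coherent (hS : Ergodic S μ)
    (h : ∀ n, ∃ f : X → ZMod (O.k n), IsEigenfunction μ S f) :
    ∃ a : ∀ n, X → ZMod (O.k n), (∀ n, IsEigenfunction μ S (a n)) ∧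
      ∀ x n, O.reduce n.le_succ (a (n + 1) x) = a n x := by
  obtain ⟨a, ha, hcoh⟩ := O.exists_coherent_ae hS h
  let Z : Set X := ⋂ n, {x | O.reduce n.le_succ (a (n + 1) x) = a n x}
  have hZ : MeasurableSet Z := MeasurableSet.iInter fun n => measurableSet_eq_fun
    (Measurable.of_discrete.comp (ha (n + 1)).measurable) (ha n).measurable
  have hZ_ae : ∀ᵐ x ∂μ, x ∈ Z := by
    filter_upwards [ae_all_iff.2 hcoh] with x hx using mem_iInter.2 hx
  refine ⟨fun n => Z.indicator (a n), fun n => (ha n).congr hS.toMeasurePreserving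
    ((ha n).measurable.indicator hZ) ?_, fun x n => ?_⟩
  · filter_upwards [hZ_ae] with x hx using (indicator_of_mem hx _).symm
  · by_cases hx : x ∈ Z
    · simp only [indicator_of_mem hx]
      exact mem_iInter.1 hx n
    · simp only [indicator_of_notMem hx, map_zero]

theorem exists_factor (hS : Ergodic S μ)
    (h : ∀ n, ∃ f : X → ZMod (O.k n), IsEigenfunction μ S f) :
    ∃ Φ : X → O.Space, Measurable Φ ∧ ∀ n, IsEigenfunction μ S fun x => O.coord n (Φ x) := by
  obtain ⟨a, ha, hcoh⟩ := O.exists_coherent hS h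
  refine ⟨fun x => O.ofCoherent (fun n => a n x) (hcoh x),
    O.measurable_of_measurable_coord fun n => ?_, fun n => ?_⟩
  · simpa only [coord_ofCoherent] using (ha n).measurable
  · simpa only [coord_ofCoherent] using ha n

theorem measurePreserving_of_isEigenfunction_coord [IsProbabilityMeasure μ]
    (hS : MeasurePreserving S μ μ) {Φ : X → O.Space} (hΦ : Measurable Φ)
    (h : ∀ n, IsEigenfunction μ S fun x => O.coord n (Φ x)) :
    MeasurePreserving Φ μ O.measure := by
  have := Measure.isProbabilityMeasure_map (μ := μ) hΦ.aemeasurable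
  refine ⟨hΦ, O.eq_measure fun n c => ?_⟩
  rw [Measure.map_apply hΦ (O.measurable_coord n (measurableSet_singleton c)), ← preimage_comp,
    ← ENNReal.toReal_eq_toReal_iff' (measure_ne_top _ _) (by simp [(O.k_pos n).ne']),
    ENNReal.toReal_inv, ENNReal.toReal_natCast, ← one_div]
  exact (h n).measureReal_fibre hS c

end Factor

end OdometerSeq

namespace RankOneConstruction

section Combinatorics

variable {X : Type*} [MeasurableSpace X] {μ : Measure X} {T : Transformation μ}
  (R : RankOneConstruction T)

/-- The index, in the tower of stage `n + 1`, of the bottom level of the `(j + 1)`-st copy of the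
stage-`n` tower: the copies are stacked in order, each followed by its spacers. -/
def offset (n j : ℕ) : ℕ := ∑ i ∈ Finset.range j, (R.h n + R.s n (i + 1))

theorem offset_succ (n j : ℕ) : R.offset n (j + 1) = R.offset n j + (R.h n + R.s n (j + 1)) :=
  Finset.sum_range_succ _ _

theorem offset_r (n : ℕ) : R.offset n (R.r n) = R.h (n + 1) := by
  rw [h, towerHeight, ← h, offset, Finset.sum_add_distrib, Finset.sum_const, Finset.card_range,
    smul_eq_mul, Finset.range_eq_Ico, Finset.sum_Ico_add' (fun i => R.s n i) 0 (R.r n) 1, zero_add]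
  rfl

theorem offset_add_le {n j : ℕ} (hj : j < R.r n) : R.offset n j + R.h n ≤ R.h (n + 1) := by
  have hle : R.offset n (j + 1) ≤ R.offset n (R.r n) :=
    Finset.sum_le_sum_of_subset (Finset.range_mono hj)
  rw [offset_succ, offset_r] at hle
  omega

theorem two_pow_le_h (n : ℕ) : 2 ^ n ≤ R.h n := by
  induction n with
  | zero => exact le_rfl
  | succ n ih =>
    calc
      2 ^ (n + 1) = 2 * 2 ^ n := pow_succ' 2 n
      _ ≤ R.r n * R.h n := Nat.mul_le_mul (R.one_lt_r n) ih
      _ ≤ R.h (n + 1) := Nat.le_add_right _ _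

theorem spacer_ae_eq {n i j : ℕ} (hi : 0 < i) (hir : i ≤ R.r n) (hj : j < R.s n i) :
    R.C n i (j + 1) =ᵐ[μ] T.image (R.h n + j) (R.B' n i) := by
  induction j with
  | zero => exact (R.top_to_spacer n i hi hir hj.ne').symm
  | succ j ih =>
    rw [← add_assoc, ← T.image_image]
    exact (R.spacer_to_spacer n i (j + 1) hi hir j.succ_pos hj).symm.trans
      (T.image_congr 1 (ih (j.lt_succ_self.trans hj)))

theorem next_piece_ae_eq {n i : ℕ} (hi : 0 < i) (hir : i < R.r n) :
    R.B' n (i + 1) =ᵐ[μ] T.image (R.h n + R.s n i) (R.B' n i) := by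
  rcases hs : R.s n i with _ | j
  · exact (R.top_to_piece n i hi hir hs).symm
  · have hspacer := R.spacer_to_piece n i hi hir (by omega)
    rw [hs] at hspacer
    rw [← add_assoc, ← T.image_image]
    exact hspacer.symm.trans (T.image_congr 1 (R.spacer_ae_eq hi hir.le (by omega)))

theorem piece_ae_eq {n j : ℕ} (hj : j < R.r n) :
    R.B' n (j + 1) =ᵐ[μ] T.image (R.offset n j) (R.B (n + 1)) := by
  induction j with
  | zero => exact (R.base_succ n).symm
  | succ j ih =>
    rw [offset_succ, ← T.image_image]
    exact (R.next_piece_ae_eq j.succ_pos hj).trans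
      (T.image_congr _ (ih (j.lt_succ_self.trans hj)))

theorem base_ae_eq (n : ℕ) :
    R.B n =ᵐ[μ] ⋃ j ∈ Finset.range (R.r n), T.image (R.offset n j) (R.B (n + 1)) := by
  have hIcc : Finset.Icc 1 (R.r n) = (Finset.range (R.r n)).image (· + 1) := by
    rw [Finset.range_eq_Ico, Finset.image_add_right_Ico, zero_add]
    rfl
  have hunion := R.pieces_union n
  rw [hIcc, Finset.set_biUnion_finset_image] at hunion
  exact hunion.symm.trans
    (Finset.eventuallyEq_iUnion _ fun j hj => R.piece_ae_eq (Finset.mem_range.1 hj))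

theorem exists_refine_base {m n : ℕ} (hmn : m ≤ n) : ∃ J : Finset ℕ,
    (∀ i ∈ J, i + R.h m ≤ R.h n) ∧ R.B m =ᵐ[μ] ⋃ i ∈ J, T.image i (R.B n) := by
  induction n, hmn using Nat.le_induction with
  | base =>
    refine ⟨{0}, by simp, ?_⟩
    rw [Finset.set_biUnion_singleton]
    exact ae_eq_refl _
  | succ n _ ih =>
    obtain ⟨J, hJ, hB⟩ := ih
    refine ⟨J.biUnion fun i => (Finset.range (R.r n)).image fun j => R.offset n j + i, ?_, ?_⟩
    · intro a ha
      simp only [Finset.mem_biUnion, Finset.mem_image, Finset.mem_range] at ha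
      obtain ⟨i, hi, j, hj, rfl⟩ := ha
      have := hJ i hi
      have := R.offset_add_le hj
      omega
    · simp only [Finset.set_biUnion_biUnion, Finset.set_biUnion_finset_image, ← T.image_image,
        ← T.image_biUnion]
      exact hB.trans (Finset.eventuallyEq_iUnion _ fun i _ => T.image_congr i (R.base_ae_eq n))

theorem measure_image (i n : ℕ) : μ (T.image i (R.B n)) = μ (R.B n) :=
  (T.invertible.inv_preserving.measurePreserving_completion.iterate i).measure_preimage
    (R.measurable_B n).nullMeasurableSet

theorem measure_biUnion_image_eq_zero {n : ℕ} (h : μ (R.B n) = 0) (f : ℕ → ℕ) (D : Finset ℕ) :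
    μ (⋃ i ∈ D, T.image (f i) (R.B n)) = 0 :=
  (measure_biUnion_null_iff D.countable_toSet).2 fun i _ => by rw [measure_image, h]

theorem measure_base_eq_zero_iff (n : ℕ) : μ (R.B n) = 0 ↔ μ (R.B 0) = 0 := by
  induction n with
  | zero => rfl
  | succ n ih =>
    rw [← ih, measure_congr (R.base_ae_eq n)]
    refine ⟨fun h => R.measure_biUnion_image_eq_zero h _ _, fun h => ?_⟩
    rw [← R.measure_image (R.offset n 0)]
    exact (measure_biUnion_null_iff (Finset.countable_toSet _)).1 h 0
      (Finset.mem_coe.2 (Finset.mem_range.2 (one_pos.trans (R.one_lt_r n))))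

variable [IsProbabilityMeasure μ]

theorem measure_base_ne_zero (n : ℕ) : μ (R.B n) ≠ 0 := by
  intro hn
  obtain ⟨m, D, -, hlt⟩ := R.dense univ .univ 1 one_pos
  have hm : μ (R.B m) = 0 := (R.measure_base_eq_zero_iff m).2 ((R.measure_base_eq_zero_iff n).1 hn)
  have hnull := ae_eq_empty.2 (R.measure_biUnion_image_eq_zero hm (fun i => i) D)
  rw [measure_congr ((ae_eq_refl univ).symmDiff hnull), ← bot_eq_empty, symmDiff_bot,
    measure_univ] at hlt
  exact lt_irrefl _ hlt

theorem I_eq_of_base_ae_eq {m n : ℕ} {J : Finset ℕ} (hJ : J ⊆ Finset.range (R.h n))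
    (hB : R.B m =ᵐ[μ] ⋃ i ∈ J, T.image i (R.B n)) : R.I m n = J := by
  ext i
  simp only [I, Finset.mem_filter, Finset.mem_range]
  refine ⟨fun ⟨hin, hi⟩ => ?_, fun hi => ⟨Finset.mem_range.1 (hJ hi), ?_⟩⟩
  · by_contra hiJ
    refine R.measure_base_ne_zero n ?_
    have hdisj : AEDisjoint μ (T.image i (R.B n)) (⋃ j ∈ J, T.image j (R.B n)) := by
      rw [AEDisjoint, inter_iUnion₂]
      refine (measure_biUnion_null_iff J.countable_toSet).2 fun j hj => ?_
      exact R.levels_disjoint n i j hin (Finset.mem_range.1 (hJ hj)) fun h => hiJ (h ▸ hj)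
    have hle := (EventuallyLE.refl (ae μ) (T.image i (R.B n))).inter (hi.trans hB.le)
    rw [inter_self] at hle
    rw [← R.measure_image i n]
    exact measure_mono_null_ae hle hdisj
  · exact (subset_biUnion_of_mem (u := fun i => T.image i (R.B n)) hi).eventuallyLE.trans hB.symm.le

theorem refine_base {m n : ℕ} (hmn : m ≤ n) :
    (∀ i ∈ R.I m n, i + R.h m ≤ R.h n) ∧ R.B m =ᵐ[μ] ⋃ i ∈ R.I m n, T.image i (R.B n) := by
  obtain ⟨J, hJ, hB⟩ := R.exists_refine_base hmn
  have hJn : J ⊆ Finset.range (R.h n) := fun i hi => by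
    have := hJ i hi
    have := (pow_pos two_pos m).trans_le (R.two_pow_le_h m)
    exact Finset.mem_range.2 (by omega)
  rw [R.I_eq_of_base_ae_eq hJn hB]
  exact ⟨hJ, hB⟩

theorem exists_biUnion_image_approx {A : Set X} (hA : NullMeasurableSet A μ) {ε : ℝ}
    (hε : 0 < ε) : ∃ (n : ℕ) (D : Finset ℕ), D ⊆ Finset.range (R.h n) ∧
      μ.real (symmDiff A (⋃ i ∈ D, T.image i (R.B n))) < ε := by
  obtain ⟨A', -, hA', hae⟩ := hA.exists_measurable_superset_ae_eq
  obtain ⟨n, D, hD, hlt⟩ := R.dense A' hA' (ENNReal.ofReal ε) (ENNReal.ofReal_pos.2 hε)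
  have hsymmDiff : symmDiff A (⋃ i ∈ D, T.image i (R.B n)) =ᵐ[μ]
      symmDiff A' (⋃ i ∈ D, T.image i (R.B n)) := hae.symm.symmDiff (ae_eq_refl _)
  exact ⟨n, D, hD, (ENNReal.lt_ofReal_iff_toReal_lt (measure_ne_top _ _)).1
    ((measure_congr hsymmDiff).trans_lt hlt)⟩

end Combinatorics

section Towers

variable {X : Type*} [MeasurableSpace X] {μ : Measure X} [IsProbabilityMeasure μ]
  {T : Transformation μ} (R : RankOneConstruction T)

/-- The towers of a rank-one construction. The completed measure is used since `T` and the bases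
are only measurable modulo null sets. -/
noncomputable def towers : TowerSystem μ.completion where
  S := T.invFun
  preserving := T.invertible.inv_preserving.measurePreserving_completion
  B := R.B
  measurableSet_base := R.measurable_B
  base_ne_zero := R.measure_base_ne_zero
  h := R.h
  two_pow_le := R.two_pow_le_h
  I := R.I
  I_add_le _ _ hmn := (R.refine_base hmn).1
  refine_base _ _ hmn := (R.refine_base hmn).2
  levels_disjoint := R.levels_disjoint
  dense _ hA _ hε := R.exists_biUnion_image_approx hA hε

theorem residueCondition_iff {l k : ℕ} {ε : ℝ} : R.ResidueCondition l ε k ↔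
    R.towers.HasReturnResidue k ∧ R.towers.HasResidueApprox l ε k := by
  refine ⟨fun h => ⟨fun η hη => ?_, ?_⟩, fun ⟨hreturn, happrox⟩ η hη => ?_⟩
  · obtain ⟨N, hN⟩ := h η hη
    exact eventually_atTop.2 ⟨N, fun m hm n hmn => (hN m n hm hmn).1⟩
  · obtain ⟨N, hN⟩ := h 1 one_pos
    exact eventually_atTop.2 ⟨N, fun m hm => (hN m (m + 1) hm m.lt_succ_self).2⟩
  · obtain ⟨N, hN⟩ := eventually_atTop.1 ((hreturn η hη).and happrox)
    exact ⟨N, fun m n hm hmn => ⟨(hN m hm).1 n hmn, (hN m hm).2⟩⟩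

end Towers

end RankOneConstruction

namespace TowerSystem

variable {X Y : Type*} [MeasurableSpace X] [mY : MeasurableSpace Y] {μ : Measure X}
  [IsFiniteMeasure μ] (W : TowerSystem μ) {Φ : X → Y}

theorem eventuallyMeasurableSet_level {l : ℕ}
    (h : ∀ δ : ℝ, 0 < δ → ∃ (k : ℕ) (f : Y → ZMod k) (E : Set (ZMod k)), Measurable f ∧
      IsEigenfunction μ W.S (f ∘ Φ) ∧ μ.real (symmDiff (W.B l) (f ∘ Φ ⁻¹' E)) < δ) (i : ℕ) :
    EventuallyMeasurableSet (mY.comap Φ) (ae μ) (W.level l i) := by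
  refine eventuallyMeasurableSet_of_forall_approx fun δ hδ => ?_
  obtain ⟨k, f, E, hf, hfΦ, hlt⟩ := h δ hδ
  refine ⟨{x | f (Φ x) - i ∈ E}, MeasurableSet.eventuallyMeasurableSet
    ⟨f ⁻¹' {c | c - i ∈ E}, hf .of_discrete, rfl⟩, ?_⟩
  calc
    μ.real (symmDiff (W.level l i) {x | f (Φ x) - i ∈ E})
      = μ.real (W.S^[i] ⁻¹' symmDiff (W.B l) (f ∘ Φ ⁻¹' E)) :=
        measureReal_congr ((ae_eq_refl _).symmDiff (hfΦ.preimage_iterate W.preserving i E).symm)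
    _ = μ.real (symmDiff (W.B l) (f ∘ Φ ⁻¹' E)) :=
        (W.preserving.iterate i).measureReal_preimage ((W.measurableSet_base l).symmDiff
          (hfΦ.measurableSet_preimage E)).nullMeasurableSet
    _ < δ := hlt

theorem eventuallyMeasurableSet_of_measurableSet
    (h : ∀ l, ∀ δ : ℝ, 0 < δ → ∃ (k : ℕ) (f : Y → ZMod k) (E : Set (ZMod k)), Measurable f ∧
      IsEigenfunction μ W.S (f ∘ Φ) ∧ μ.real (symmDiff (W.B l) (f ∘ Φ ⁻¹' E)) < δ)
    {A : Set X} (hA : MeasurableSet A) : EventuallyMeasurableSet (mY.comap Φ) (ae μ) A := by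
  refine eventuallyMeasurableSet_of_forall_approx fun δ hδ => ?_
  obtain ⟨n, D, -, hlt⟩ := W.dense A hA δ hδ
  exact ⟨_, @MeasurableSet.biUnion X ℕ (eventuallyMeasurableSpace _ _) _ _ D.countable_toSet
    fun i _ => W.eventuallyMeasurableSet_level (h n) i, hlt⟩

end TowerSystem

theorem OdometerSeq.exists_coord_approx (O : OdometerSeq) {X : Type*} [MeasurableSpace X]
    {μ : Measure X} {φ : X → O.Space} {ψ : O.Space → X} (hφψ : IsInvertibleMod0 μ O.measure φ ψ)
    {A : Set X} (hA : NullMeasurableSet A μ) {δ : ℝ} (hδ : 0 < δ) :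
    ∃ (n : ℕ) (E : Set (ZMod (O.k n))),
      μ.real (symmDiff A ((fun x => O.coord n (φ x)) ⁻¹' E)) < δ := by
  obtain ⟨G, -, hGm, hG⟩ :=
    (hφψ.inv_preserving.nullMeasurableSet_preimage hA).exists_measurable_superset_ae_eq
  obtain ⟨n, E, hE⟩ := O.exists_cylinder_approx hGm hδ
  have hAG : A =ᵐ[μ] φ ⁻¹' G := by
    filter_upwards [hφψ.left_inv, hφψ.map_preserving.ae hG.mem_iff] with x hψφ hx
    apply propext
    change x ∈ A ↔ φ x ∈ G
    rw [hx, mem_preimage, hψφ]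
  refine ⟨n, E, lt_of_eq_of_lt ?_ hE⟩
  have hGE := hGm.symmDiff (O.measurable_coord n (MeasurableSet.of_discrete (s := E)))
  calc
    μ.real (symmDiff A ((fun x => O.coord n (φ x)) ⁻¹' E))
      = μ.real (φ ⁻¹' symmDiff G (O.coord n ⁻¹' E)) :=
        measureReal_congr (hAG.symmDiff (ae_eq_refl _))
    _ = O.measure.real (symmDiff G (O.coord n ⁻¹' E)) :=
        congrArg ENNReal.toReal (hφψ.map_preserving _ hGE).2

/- The towers are indexed by preimages under `T⁻¹`, so eigenfunctions are taken for `T⁻¹`. -/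
theorem Transformation.isEigenfunction_invFun_iff {X : Type*} [MeasurableSpace X] {μ : Measure X}
    (T : Transformation μ) {k : ℕ} {f : X → ZMod k} :
    IsEigenfunction μ.completion T.invFun f ↔
      (∀ E, NullMeasurableSet (f ⁻¹' E) μ) ∧ ∀ᵐ x ∂μ, f (T.toFun x) = f x + 1 := by
  refine ⟨fun h => ⟨h.measurableSet_preimage, ?_⟩, fun ⟨hf, h⟩ => ⟨fun E _ => hf E, ?_⟩⟩
  · have hinv : ∀ᵐ x ∂μ, f (T.invFun x) + 1 = f x := h.map_add_one
    filter_upwards [T.invertible.left_inv, T.invertible.map_preserving.ae hinv] with x hx hTx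
    rw [← hTx, hx]
  · change ∀ᵐ x ∂μ, f (T.invFun x) + 1 = f x
    filter_upwards [T.invertible.right_inv, T.invertible.inv_preserving.ae h] with x hx hinv
    rw [← hinv, hx]

namespace RankOneConstruction

variable {X : Type*} [MeasurableSpace X] {μ : Measure X} {T : Transformation μ}
  (R : RankOneConstruction T)

theorem exists_residueCondition [IsProbabilityMeasure μ] {O : OdometerSeq}
    (hO : AreIsomorphic μ T.toFun O.measure O.shift) (l : ℕ) {ε : ℝ} (hε : 0 < ε) :
    ∃ k, 1 < k ∧ R.ResidueCondition l ε k := by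
  obtain ⟨φ, ψ, hφψ, hint⟩ := hO
  have hwidth := R.towers.width_pos l
  obtain ⟨n, E, hE⟩ := O.exists_coord_approx hφψ (R.measurable_B l)
    (show 0 < ε / 4 * R.towers.width l by positivity)
  have hcoord : IsEigenfunction μ.completion T.invFun fun x => O.coord n (φ x) := by
    refine T.isEigenfunction_invFun_iff.2
      ⟨fun E' => (hφψ.map_preserving _ (O.measurable_coord n .of_discrete)).1, ?_⟩
    filter_upwards [hint] with x hx
    rw [hx, O.coord_shift]
  exact ⟨O.k n, O.one_lt n, R.residueCondition_iff.2
    ⟨TowerSystem.hasReturnResidue_of_isEigenfunction hcoord,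
      TowerSystem.hasResidueApprox_of_measureReal_lt hcoord hε hE⟩⟩

theorem areIsomorphic_of_isEigenfunction_coord (hμ : IsStandardLebesgue μ) (O : OdometerSeq)
    {Φ : X → O.Space}
    (hΦ : ∀ n, IsEigenfunction μ.completion T.invFun fun x => O.coord n (Φ x))
    (hbase : ∀ l, ∀ δ : ℝ, 0 < δ → ∃ (n : ℕ) (E : Set (ZMod (O.k n))),
      μ.real (symmDiff (R.B l) ((fun x => O.coord n (Φ x)) ⁻¹' E)) < δ) :
    AreIsomorphic μ T.toFun O.measure O.shift := by
  have := hμ.isProbabilityMeasure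
  have hΦm := O.measurable_of_measurable_coord fun n => (hΦ n).measurable
  have hpres := O.measurePreserving_of_isEigenfunction_coord R.towers.preserving hΦm hΦ
  have hΦ_mod0 : IsMeasurePreservingMod0 μ O.measure Φ := fun A hA =>
    ⟨hΦm hA, hpres.measure_preimage hA.nullMeasurableSet⟩
  obtain ⟨φ, ψ, hφψ⟩ := hμ
  obtain ⟨Ψ, hΨ⟩ := hφψ.exists_of_le_eventuallyMeasurableSpace hΦ_mod0 fun A hA =>
    R.towers.eventuallyMeasurableSet_of_measurableSet (fun l δ hδ => by
      obtain ⟨n, E, hE⟩ := hbase l δ hδ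
      exact ⟨O.k n, O.coord n, E, O.measurable_coord n, hΦ n, hE⟩) hA.nullMeasurableSet
  refine ⟨Φ, Ψ, hΨ, ?_⟩
  filter_upwards [ae_all_iff.2 fun n => (T.isEigenfunction_invFun_iff.1 (hΦ n)).2] with x hx
  exact O.ext_coord fun n => by rw [hx n, O.coord_shift]

/-- A choice, for all `l` and `ε > 0`, of a number `κ l ε > 1` as in condition (II). The values
`κ l ε` with `ε ≤ 0` are irrelevant. -/
def IsResidueChoice (κ : ℕ → ℝ → ℕ) : Prop :=
  ∀ l : ℕ, ∀ ε : ℝ, 0 < ε → 1 < κ l ε ∧ R.ResidueCondition l ε (κ l ε)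

/-- The set of all divisors of the numbers `κ l ε`, which is the set `K` of the theorem. -/
def residueDivisors (κ : ℕ → ℝ → ℕ) : Set ℕ :=
  {d | ∃ l : ℕ, ∃ ε : ℝ, 0 < ε ∧ d ∣ κ l ε}

theorem mem_residueDivisors (κ : ℕ → ℝ → ℕ) (l : ℕ) {ε : ℝ} (hε : 0 < ε) :
    κ l ε ∈ residueDivisors κ :=
  ⟨l, ε, hε, dvd_rfl⟩

namespace IsResidueChoice

variable {R} {κ : ℕ → ℝ → ℕ}

theorem zero_notMem (hκ : R.IsResidueChoice κ) : 0 ∉ residueDivisors κ := by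
  rintro ⟨l, ε, hε, hd⟩
  exact (Nat.zero_lt_of_lt (hκ l ε hε).1).ne' (Nat.eq_zero_of_zero_dvd hd)

variable [IsProbabilityMeasure μ]

theorem exists_isEigenfunction (hκ : R.IsResidueChoice κ) {d : ℕ} (hd : d ∈ residueDivisors κ) :
    ∃ f : X → ZMod d, IsEigenfunction μ.completion T.invFun f := by
  obtain ⟨l, ε, hε, hdvd⟩ := hd
  obtain ⟨hlt, hres⟩ := hκ l ε hε
  have : NeZero (κ l ε) := ⟨(Nat.zero_lt_of_lt hlt).ne'⟩
  obtain ⟨f, hf⟩ := R.towers.exists_isEigenfunction_of_hasReturnResidue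
    (R.residueCondition_iff.1 hres).1
  exact ⟨_, hf.cast hdvd⟩

theorem exists_measureReal_le (hκ : R.IsResidueChoice κ) (l : ℕ) {ε : ℝ} (hε : 0 < ε)
    {f : X → ZMod (κ l ε)} (hf : IsEigenfunction μ.completion T.invFun f) :
    ∃ E : Set (ZMod (κ l ε)),
      μ.completion.real (symmDiff (R.B l) (f ⁻¹' E)) ≤ 2 * ε * R.towers.width l := by
  have : NeZero (κ l ε) := ⟨(Nat.zero_lt_of_lt (hκ l ε hε).1).ne'⟩
  exact TowerSystem.exists_measureReal_le_of_hasResidueApprox hf hε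
    (R.residueCondition_iff.1 (hκ l ε hε).2).2

/- The tolerance `1 / 10` is the one for which bases are approximated up to a fifth of their
measure, as `eventually_dvd_of_measureReal_le` requires. -/
theorem eventually_dvd (hκ : R.IsResidueChoice κ) {d : ℕ} (hd : d ∈ residueDivisors κ) :
    ∀ᶠ l in atTop, d ∣ κ l (1 / 10) := by
  have : NeZero d := ⟨fun h => hκ.zero_notMem (h ▸ hd)⟩
  obtain ⟨f, hf⟩ := hκ.exists_isEigenfunction hd
  filter_upwards [TowerSystem.eventually_dvd_of_measureReal_le (W := R.towers) hf] with l hl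
  have hpos : (0 : ℝ) < 1 / 10 := by norm_num
  obtain ⟨g, hg⟩ := hκ.exists_isEigenfunction (mem_residueDivisors κ l hpos)
  obtain ⟨E, hE⟩ := hκ.exists_measureReal_le l hpos hg
  exact hl _ g E hg (hE.trans_eq (by ring))

theorem infinite (hκ : R.IsResidueChoice κ) : (residueDivisors κ).Infinite := by
  refine infinite_of_forall_exists_gt fun M => ?_
  obtain ⟨l, hwidth⟩ :=
    (R.towers.eventually_width_lt (show (0 : ℝ) < 1 / (2 * (M + 1)) by positivity)).exists
  have hpos : (0 : ℝ) < 1 / 10 := by norm_num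
  have hmem := mem_residueDivisors κ l hpos
  refine ⟨_, hmem, ?_⟩
  have : NeZero (κ l (1 / 10)) := ⟨fun h => hκ.zero_notMem (h ▸ hmem)⟩
  obtain ⟨f, hf⟩ := hκ.exists_isEigenfunction hmem
  obtain ⟨E, hE⟩ := hκ.exists_measureReal_le l hpos hf
  have hlt : 1 / (κ l (1 / 10) : ℝ) < 2 * R.towers.width l :=
    hf.one_div_lt_of_measureReal_symmDiff_lt R.towers.preserving
      (hE.trans_lt (show 2 * (1 / 10) * R.towers.width l < R.towers.width l by
        linarith [R.towers.width_pos l]))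
  have hκ_pos : (0 : ℝ) < κ l (1 / 10) := by exact_mod_cast NeZero.pos (κ l (1 / 10))
  have hM : (M : ℝ) + 1 < κ l (1 / 10) := by
    refine lt_of_one_div_lt_one_div hκ_pos (hlt.trans ?_)
    calc
      2 * R.towers.width l < 2 * (1 / (2 * (M + 1))) := by gcongr
      _ = 1 / (M + 1) := by field_simp
  exact_mod_cast (lt_add_one (M : ℝ)).trans hM

theorem exists_divisorSet_eq (hκ : R.IsResidueChoice κ) :
    ∃ O : OdometerSeq, O.divisorSet = residueDivisors κ := by
  refine OdometerSeq.exists_divisorSet_eq hκ.zero_notMem ?_ ?_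
    ⟨κ 0 1, mem_residueDivisors κ 0 one_pos, (hκ 0 1 one_pos).1⟩
  · rintro a ⟨l, ε, hε, ha⟩ d hd
    exact ⟨l, ε, hε, hd.trans ha⟩
  · intro a ha b hb
    obtain ⟨l, hal, hbl⟩ := ((hκ.eventually_dvd ha).and (hκ.eventually_dvd hb)).exists
    exact ⟨_, mem_residueDivisors κ l (by norm_num), hal, hbl⟩

theorem areIsomorphic (hμ : IsStandardLebesgue μ) (hκ : R.IsResidueChoice κ) {O : OdometerSeq}
    (hO : O.divisorSet = residueDivisors κ) : AreIsomorphic μ T.toFun O.measure O.shift := by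
  obtain ⟨Φ, -, hΦ⟩ := O.exists_factor R.towers.ergodic fun n =>
    hκ.exists_isEigenfunction (hO ▸ ⟨n, dvd_rfl⟩)
  refine R.areIsomorphic_of_isEigenfunction_coord hμ O hΦ fun l δ hδ => ?_
  have hwidth := R.towers.width_pos l
  have hε : 0 < δ / (4 * R.towers.width l) := by positivity
  obtain ⟨n, hdvd⟩ : κ l (δ / (4 * R.towers.width l)) ∈ O.divisorSet :=
    hO ▸ mem_residueDivisors κ l hε
  obtain ⟨E, hE⟩ := hκ.exists_measureReal_le l hε ((hΦ n).cast hdvd)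
  refine ⟨n, ZMod.castHom hdvd _ ⁻¹' E, hE.trans_lt ?_⟩
  calc
    2 * (δ / (4 * R.towers.width l)) * R.towers.width l = δ / 2 := by field_simp; norm_num
    _ < δ := half_lt_self hδ

end IsResidueChoice

theorem exists_isResidueChoice
    (h : ∀ l : ℕ, ∀ ε : ℝ, 0 < ε → ∃ k : ℕ, 1 < k ∧ R.ResidueCondition l ε k) :
    ∃ κ, R.IsResidueChoice κ := by
  choose κ hκ using h
  classical
  refine ⟨fun l ε => if hε : 0 < ε then κ l ε hε else 0, fun l ε hε => ?_⟩
  simpa only [dif_pos hε] using hκ l ε hε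

end RankOneConstruction

theorem mainTheorem2 {X : Type*} [MeasurableSpace X] (μ : Measure X) (hμ : IsStandardLebesgue μ)
    (T : Transformation μ) (R : RankOneConstruction T) :
    ((∃ O : OdometerSeq, AreIsomorphic μ T.toFun O.measure O.shift) ↔
      ∀ l : ℕ, ∀ ε : ℝ, 0 < ε → ∃ k : ℕ, 1 < k ∧ R.ResidueCondition l ε k) ∧
    ∀ κ : ℕ → ℝ → ℕ,
      (∀ l : ℕ, ∀ ε : ℝ, 0 < ε → 1 < κ l ε ∧ R.ResidueCondition l ε (κ l ε)) →
      ∀ K : Set ℕ, K = {d | ∃ l : ℕ, ∃ ε : ℝ, 0 < ε ∧ d ∣ κ l ε} →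
        K.Infinite ∧ (∃ O : OdometerSeq, O.divisorSet = K) ∧
        ∀ O : OdometerSeq, O.divisorSet = K → AreIsomorphic μ T.toFun O.measure O.shift := by
  have := hμ.isProbabilityMeasure
  refine ⟨⟨fun ⟨O, hO⟩ l ε hε => R.exists_residueCondition hO l hε, fun hII => ?_⟩, ?_⟩
  · obtain ⟨κ, hκ⟩ := R.exists_isResidueChoice hII
    obtain ⟨O, hO⟩ := hκ.exists_divisorSet_eq
    exact ⟨O, hκ.areIsomorphic hμ hO⟩
  · rintro κ (hκ : R.IsResidueChoice κ) _ rfl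
    exact ⟨hκ.infinite, hκ.exists_divisorSet_eq, fun O hO => hκ.areIsomorphic hμ hO⟩
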